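/- All spaces and maps are in the topological category. A crossed module $(H,G)$ consists of topological groups $G$, $H$, a continuous homomorphism $t\colon G\to H$ and a continuous action $\alpha\colon H\to \mathrm{Aut}(G)$ of $H$ on $G$ by automorphisms (continuous as a map $H\times G\to G$), such that $t(\alpha(h)(g))=h\,t(g)\,h^{-1}$ and $\alpha(t(g))(k)=gkg^{-1}$. It is assumed throughout that the projections $G\to G/\ker t$ and $H\to H/t(G)$ admit local sections and that $t$ induces an isomorphism of topological groups from $G/\ker t$ onto $t(G)\subseteq H$ with the subspace topology. An $(H,G)$-bibundle on a space $M$ is a (locally trivial, right) principal $G$-bundle $P\to M$ with a continuous map $\psi\colon P\to H$, the structure map, such that $\psi(pg)=\psi(p)t(g)$. An isomorphism of bibundles on $M$ is an isomorphism of principal $G$-bundles over $M$ commuting with the structure maps; $\pi_0\mathbf{Bibun}_{(H,G)}(M)$ denotes the set of isomorphism classes. $G$ acts on the left of a bibundle by $gp=p\,\alpha(\psi(p))^{-1}(g)$. The set $\pi_0\mathbf{Bibun}_{(H,G)}(M)$ is a group under the tensor product $P\otimes Q=(P\times_M Q)/G$, where $G$ acts by $(p,q)g=(pg,g^{-1}q)$,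 with right action $(p\otimes q)g=p\otimes qg$ and structure map $p\otimes q\mapsto\psi(p)\psi(q)$. The unit is the class of $M\times G$ with structure map $(m,g)\mapsto t(g)$, and $[P]^{-1}=[P^*]$, where $P^*$ is $P$ with right action $p\cdot g=g^{-1}p$ and structure map $p\mapsto\psi(p)^{-1}$. Let $EG$ be a topological group that contains $G$ as a closed subgroup, is contractible, and is such that $EG\to EG/G$ is a principal $G$-bundle (a model of the universal $G$-bundle). Suppose that the action of $H$ on $G$ extends to a continuous action $\alpha$ of $H$ on $EG$ by automorphisms with $\alpha(t(g))(e)=geg^{-1}$ for $g\in G$, $e\in EG$. Let $E(H,G)=EG\rtimes H$ be the semidirect product, with $(e,h)(e',h')=(e\,\alpha(h)(e'),hh')$, and let $B(H,G)=E(H,G)/G$ be its quotient by the normal subgroup $\{(g^{-1},t(g)) : g\in G\}$. Then $E(H,G)\to B(H,G)$ is a homomorphism of topological groups, and it is an $(H,G)$-bibundle with right action $(e,h)g=(e,h)(g^{-1},t(g))$ and structure map $(e,h)\mapsto h$. Let $[M,B(H,G)]_{H/t(G)}$ be the set of continuous maps $F\colon M\to B(H,G)$ modulo homotopies whose composite with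 the homomorphism $B(H,G)\to H/t(G)$, $[e,h]\mapsto[h]$, is constant in time; it is a group under pointwise multiplication of maps. Theorem. For every paracompact Hausdorff space $M$ there is an isomorphism of groups \[ \pi_0\mathbf{Bibun}_{(H,G)}(M)\;\cong\;[M,B(H,G)]_{H/t(G)}, \] under which the homotopy class over $H/t(G)$ of a map $F\colon M\to B(H,G)$ corresponds to the isomorphism class of the pullback bibundle $F^*E(H,G)$. -/

import Mathlib

open Topology

set_option linter.unusedSectionVars false

universe u

/-! ## Local sections, crossed modules -/

/-- The map `f : X → Y` admits local sections: every point of `Y` has an open neighbourhood over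
which `f` has a continuous section. -/
def HasLocalSections {X Y : Type*} [TopologicalSpace X] [TopologicalSpace Y] (f : X → Y) : Prop :=
  ∀ y : Y, ∃ U : Set Y, IsOpen U ∧ y ∈ U ∧ ∃ s : U → X, Continuous s ∧ ∀ v : U, f (s v) = v

/-- A crossed module `G → H → Aut(G)` of topological groups. -/
structure CrossedModule (H G : Type u) [Group H] [TopologicalSpace H] [Group G]
    [TopologicalSpace G] where
  t : G →* H
  continuous_t : Continuous t
  α : H →* MulAut G
  continuous_α : Continuous fun x : H × G => α x.1 x.2
  t_α : ∀ (h : H) (g : G), t (α h g) = h * t g * h⁻¹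
  α_t : ∀ g k : G, α (t g) k = g * k * g⁻¹

namespace CrossedModule

variable {H G : Type u} [Group H] [TopologicalSpace H] [Group G] [TopologicalSpace G]

instance normal_range (X : CrossedModule H G) : X.t.range.Normal where
  conj_mem := by
    rintro _ ⟨g, rfl⟩ h
    exact ⟨X.α h g, X.t_α h g⟩

theorem α_α_inv (X : CrossedModule H G) (h : H) (g : G) : X.α h (X.α h⁻¹ g) = g := by
  rw [← MulAut.mul_apply, ← map_mul, mul_inv_cancel, map_one, MulAut.one_apply]

theorem α_inv_α (X : CrossedModule H G) (h : H) (g : G) : X.α h⁻¹ (X.α h g) = g := by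
  rw [← MulAut.mul_apply, ← map_mul, inv_mul_cancel, map_one, MulAut.one_apply]

theorem α_inv_t_mul (X : CrossedModule H G) (k : G) (h : H) (g : G) :
    X.α (X.t k * h)⁻¹ g = X.α h⁻¹ (k⁻¹ * g * k) := by
  rw [mul_inv_rev, map_mul, MulAut.mul_apply, ← map_inv, X.α_t, inv_inv]

theorem α_inv_mul_t (X : CrossedModule H G) (h : H) (k g : G) :
    X.α (h * X.t k)⁻¹ g = k⁻¹ * X.α h⁻¹ g * k := by
  rw [mul_inv_rev, map_mul, MulAut.mul_apply, ← map_inv, X.α_t, inv_inv]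

/-- The standing assumptions on a crossed module: the projections `G → G / ker t` and
`H → H / t(G)` admit local sections, and `t(G) ⊆ H`, with the subspace topology, is `G / ker t`
as a topological group. -/
structure IsAdmissible (X : CrossedModule H G) : Prop where
  localSections_ker : HasLocalSections (QuotientGroup.mk : G → G ⧸ X.t.ker)
  localSections_range : HasLocalSections (QuotientGroup.mk : H → H ⧸ X.t.range)
  isHomeomorph_range : IsHomeomorph (QuotientGroup.quotientKerEquivRange X.t)

end CrossedModule

/-! ## Principal bundles -/

/-- The map `proj : P → M`, with the right action `act` of `G` on `P`, is locally isomorphic, as a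
space over `M` with right `G`-action, to `M × G`. -/
def IsLocallyTrivial {P M G : Type*} [TopologicalSpace P] [TopologicalSpace M]
    [TopologicalSpace G] [Group G] (proj : P → M) (act : P → G → P) : Prop :=
  ∀ m : M, ∃ e : Bundle.Trivialization G proj, m ∈ e.baseSet ∧
    ∀ p ∈ e.source, ∀ g : G, act p g ∈ e.source ∧ e (act p g) = ((e p).1, (e p).2 * g)

/-- A (right, locally trivial) principal `G`-bundle on `M`. -/
structure PrincipalBundle (G M : Type u) [Group G] [TopologicalSpace G]
    [TopologicalSpace M] where
  Total : Type u
  [top : TopologicalSpace Total]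
  /-- the right action of `G` -/
  act : Total → G → Total
  act_one : ∀ p, act p 1 = p
  act_act : ∀ p g k, act (act p g) k = act p (g * k)
  continuous_act : Continuous fun x : Total × G => act x.1 x.2
  proj : Total → M
  continuous_proj : Continuous proj
  proj_act : ∀ p g, proj (act p g) = proj p
  locallyTrivial : IsLocallyTrivial proj act

attribute [instance] PrincipalBundle.top
attribute [simp] PrincipalBundle.act_one PrincipalBundle.act_act PrincipalBundle.proj_act

/-- Auxiliary: a local section together with the corresponding fibre coordinate. -/
structure LocalData {P M G : Type*} [TopologicalSpace P] [TopologicalSpace M]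
    [TopologicalSpace G] [Group G] (proj : P → M) (act : P → G → P) (m : M) where
  U : Set M
  isOpen : IsOpen U
  mem : m ∈ U
  s : U → P
  d : P → G
  continuous_s : Continuous s
  proj_s : ∀ v : U, proj (s v) = v
  continuousOn_d : ContinuousOn d (proj ⁻¹' U)
  act_d : ∀ (p : P) (hp : proj p ∈ U), act (s ⟨proj p, hp⟩) (d p) = p
  d_act : ∀ p : P, proj p ∈ U → ∀ g, d (act p g) = d p * g

theorem LocalData.d_s {P M G : Type*} [TopologicalSpace P] [TopologicalSpace M]
    [TopologicalSpace G] [Group G] {proj : P → M} {act : P → G → P} {m : M}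
    (L : LocalData proj act m) (v : L.U) : L.d (L.s v) = 1 := by
  have h0 : proj (L.s v) ∈ L.U := by rw [L.proj_s]; exact v.2
  have h1 := L.act_d (L.s v) h0
  have h2 : (⟨proj (L.s v), h0⟩ : L.U) = v := Subtype.ext (L.proj_s v)
  rw [h2] at h1
  have h3 := L.d_act (L.s v) h0 (L.d (L.s v))
  rw [h1] at h3
  exact left_eq_mul.mp h3

open Classical in
theorem isLocallyTrivial_of_localData {P M G : Type*} [TopologicalSpace P] [TopologicalSpace M]
    [TopologicalSpace G] [Group G] {proj : P → M} {act : P → G → P}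
    (hproj : Continuous proj)
    (hact : Continuous fun x : P × G => act x.1 x.2)
    (hpa : ∀ p g, proj (act p g) = proj p)
    (h : ∀ m, Nonempty (LocalData proj act m)) : IsLocallyTrivial proj act := by
  intro m
  obtain ⟨L⟩ := h m
  let s' : M → P := fun x => if hx : x ∈ L.U then L.s ⟨x, hx⟩ else L.s ⟨m, L.mem⟩
  have hs' : ∀ (x : M) (hx : x ∈ L.U), s' x = L.s ⟨x, hx⟩ := fun x hx => dif_pos hx
  have cs' : ContinuousOn s' L.U := by
    rw [continuousOn_iff_continuous_domRestrict]
    convert L.continuous_s using 1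
    funext v
    exact hs' v v.2
  have ps' : ∀ x ∈ L.U, proj (s' x) = x := fun x hx => by rw [hs' x hx, L.proj_s]
  have ds' : ∀ x ∈ L.U, L.d (s' x) = 1 := fun x hx => by rw [hs' x hx, L.d_s]
  refine ⟨{ toFun := fun p => (proj p, L.d p)
            invFun := fun x => act (s' x.1) x.2
            source := proj ⁻¹' L.U
            target := L.U ×ˢ Set.univ
            map_source' := fun p hp => ⟨hp, trivial⟩
            map_target' := fun x hx => by
              change proj _ ∈ L.U
              rw [hpa, ps' _ hx.1]; exact hx.1
            left_inv' := fun p hp => by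
              change act (s' (proj p)) (L.d p) = p
              rw [hs' _ hp, L.act_d p hp]
            right_inv' := fun x hx => by
              have := L.d_act (s' x.1) (by rw [ps' _ hx.1]; exact hx.1) x.2
              rw [hpa, ps' _ hx.1, this, ds' _ hx.1, one_mul]
            open_source := L.isOpen.preimage hproj
            open_target := L.isOpen.prod isOpen_univ
            continuousOn_toFun := hproj.continuousOn.prodMk L.continuousOn_d
            continuousOn_invFun := hact.comp_continuousOn
              ((cs'.comp continuousOn_fst fun x hx => hx.1).prodMk continuousOn_snd)
            baseSet := L.U
            open_baseSet := L.isOpen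
            source_eq := rfl
            target_eq := rfl
            proj_toFun := fun _ _ => rfl }, L.mem, ?_⟩
  intro p hp g
  refine ⟨?_, ?_⟩
  · change proj _ ∈ L.U
    rw [hpa]; exact hp
  · change (proj _, L.d _) = (proj p, L.d p * g)
    rw [hpa, L.d_act p hp]

theorem IsLocallyTrivial.localData {P M G : Type*} [TopologicalSpace P] [TopologicalSpace M]
    [TopologicalSpace G] [Group G] {proj : P → M} {act : P → G → P}
    (h : IsLocallyTrivial proj act) (m : M) : Nonempty (LocalData proj act m) := by
  obtain ⟨e, hm, he⟩ := h m
  have hsrc : ∀ p, p ∈ e.source ↔ proj p ∈ e.baseSet := fun p => by rw [e.source_eq]; rfl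
  have htgt : ∀ v : e.baseSet, ((v : M), (1 : G)) ∈ e.target := fun v => by
    rw [e.target_eq]; exact ⟨v.2, trivial⟩
  have hss : ∀ v : e.baseSet, e.toOpenPartialHomeomorph.symm ((v : M), (1 : G)) ∈ e.source :=
    fun v => e.toOpenPartialHomeomorph.map_target (htgt v)
  have hes : ∀ v : e.baseSet,
      e (e.toOpenPartialHomeomorph.symm ((v : M), (1 : G))) = ((v : M), (1 : G)) :=
    fun v => e.toOpenPartialHomeomorph.right_inv (htgt v)
  refine ⟨{ U := e.baseSet
            isOpen := e.open_baseSet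
            mem := hm
            s := fun v => e.toOpenPartialHomeomorph.symm ((v : M), (1 : G))
            d := fun p => (e p).2
            continuous_s := ?_
            proj_s := ?_
            continuousOn_d := ?_
            act_d := ?_
            d_act := ?_ }⟩
  · exact e.toOpenPartialHomeomorph.continuousOn_symm.comp_continuous (by fun_prop) htgt
  · intro v
    rw [← e.proj_toFun _ (hss v)]
    exact congrArg Prod.fst (hes v)
  · rw [← e.source_eq]
    exact continuous_snd.comp_continuousOn e.toOpenPartialHomeomorph.continuousOn
  · intro p hp
    obtain ⟨h1, h2⟩ := he _ (hss ⟨proj p, hp⟩) (e p).2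
    apply e.toOpenPartialHomeomorph.injOn h1 ((hsrc p).2 hp)
    change e _ = e p
    rw [h2, hes]
    refine Prod.ext ?_ (one_mul _)
    exact (e.proj_toFun p ((hsrc p).2 hp)).symm
  · intro p hp g
    rw [(he p ((hsrc p).2 hp) g).2]

namespace PrincipalBundle

variable {G M : Type u} [Group G] [TopologicalSpace G] [IsTopologicalGroup G] [TopologicalSpace M]

end PrincipalBundle

namespace PrincipalBundle

variable {G M : Type u} [Group G] [TopologicalSpace G] [TopologicalSpace M]

theorem act_injective (P : PrincipalBundle G M) (p : P.Total) : Function.Injective (P.act p) := by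
  intro g k h
  obtain ⟨L⟩ := P.locallyTrivial.localData (P.proj p)
  have h1 := L.d_act p L.mem g
  have h2 := L.d_act p L.mem k
  rw [h] at h1
  exact mul_left_cancel (h1.symm.trans h2)

theorem exists_act_eq (P : PrincipalBundle G M) {p q : P.Total} (h : P.proj p = P.proj q) :
    ∃ g, P.act p g = q := by
  obtain ⟨L⟩ := P.locallyTrivial.localData (P.proj p)
  have hq : P.proj q ∈ L.U := h ▸ L.mem
  refine ⟨(L.d p)⁻¹ * L.d q, ?_⟩
  have h1 := L.act_d p L.mem
  have h2 := L.act_d q hq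
  have h3 : (⟨P.proj p, L.mem⟩ : L.U) = ⟨P.proj q, hq⟩ := Subtype.ext h
  calc P.act p ((L.d p)⁻¹ * L.d q)
      = P.act (P.act (L.s ⟨P.proj p, L.mem⟩) (L.d p)) ((L.d p)⁻¹ * L.d q) := by rw [h1]
    _ = P.act (L.s ⟨P.proj q, hq⟩) (L.d q) := by rw [P.act_act, mul_inv_cancel_left, h3]
    _ = q := h2

/-- A `G`-equivariant map is continuous as soon as it is so along local sections. -/
theorem continuous_of_sections [IsTopologicalGroup G] (P : PrincipalBundle G M) {Z : Type*}
    [TopologicalSpace Z] {actZ : Z → G → Z} (hZ : Continuous fun x : Z × G => actZ x.1 x.2)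
    (f : P.Total → Z) (hf : ∀ p g, f (P.act p g) = actZ (f p) g)
    (h : ∀ m : M, ∃ U : Set M, IsOpen U ∧ m ∈ U ∧ ∃ s : U → P.Total, Continuous s ∧
      (∀ v : U, P.proj (s v) = v) ∧ Continuous fun v => f (s v)) : Continuous f := by
  rw [continuous_iff_continuousAt]
  intro p
  obtain ⟨U, hU, hm, s, cs, ps, cfs⟩ := h (P.proj p)
  obtain ⟨L⟩ := P.locallyTrivial.localData (P.proj p)
  set W : Set P.Total := P.proj ⁻¹' (U ∩ L.U) with hW
  have oW : IsOpen W := (hU.inter L.isOpen).preimage P.continuous_proj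
  refine ContinuousOn.continuousAt (s := W) ?_ (oW.mem_nhds ⟨hm, L.mem⟩)
  rw [continuousOn_iff_continuous_domRestrict]
  let r : W → U := fun w => ⟨P.proj w, w.2.1⟩
  have cr : Continuous r := (P.continuous_proj.comp continuous_subtype_val).subtype_mk _
  have cd : Continuous fun w : W => L.d w :=
    L.continuousOn_d.comp_continuous continuous_subtype_val fun w => w.2.2
  have cd' : Continuous fun w : W => L.d (s (r w)) :=
    L.continuousOn_d.comp_continuous (cs.comp cr) fun w => by
      change P.proj _ ∈ L.U
      rw [ps]; exact w.2.2
  have key : ∀ w : W, f w = actZ (f (s (r w))) ((L.d (s (r w)))⁻¹ * L.d w) := by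
    intro w
    rw [← hf]
    congr 1
    obtain ⟨g, hg⟩ := P.exists_act_eq (p := s (r w)) (q := w) (ps _)
    have h1 := L.d_act (s (r w)) (by rw [ps]; exact w.2.2) g
    rw [hg] at h1
    rw [h1, inv_mul_cancel_left, hg]
  have : W.domRestrict f = fun w : W => actZ (f (s (r w))) ((L.d (s (r w)))⁻¹ * L.d w) :=
    funext key
  rw [this]
  exact hZ.comp ((cfs.comp cr).prodMk (cd'.inv.mul cd))

end PrincipalBundle

/-! ## Bibundles -/

/-- An `(H, G)`-bibundle on `M`: a principal `G`-bundle `P → M` with a structure map `ψ : P → H`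
such that `ψ (p g) = ψ(p) t(g)`; each fibre is then an `(H, G)`-bispace. -/
structure Bibundle {H G : Type u} [Group H] [TopologicalSpace H] [Group G] [TopologicalSpace G]
    (X : CrossedModule H G) (M : Type u) [TopologicalSpace M] extends PrincipalBundle G M where
  ψ : Total → H
  continuous_ψ : Continuous ψ
  ψ_act : ∀ p g, ψ (act p g) = ψ p * X.t g

attribute [simp] Bibundle.ψ_act

namespace Bibundle

variable {H G : Type u} [Group H] [TopologicalSpace H] [IsTopologicalGroup H]
  [Group G] [TopologicalSpace G] [IsTopologicalGroup G] {X : CrossedModule H G}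
  {M : Type u} [TopologicalSpace M]

/-- A morphism of bibundles on `M` covering the identity of `M`. -/
structure Hom (P Q : Bibundle X M) where
  toFun : P.Total → Q.Total
  continuous_toFun : Continuous toFun
  map_act : ∀ p g, toFun (P.act p g) = Q.act (toFun p) g
  proj_toFun : ∀ p, Q.proj (toFun p) = P.proj p
  ψ_toFun : ∀ p, Q.ψ (toFun p) = P.ψ p

/-- An isomorphism of bibundles on `M`. -/
structure Iso (P Q : Bibundle X M) where
  hom : Hom P Q
  inv : Hom Q P
  inv_hom : ∀ p, inv.toFun (hom.toFun p) = p
  hom_inv : ∀ q, hom.toFun (inv.toFun q) = q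

def Hom.id (P : Bibundle X M) : Hom P P where
  toFun := fun p => p
  continuous_toFun := continuous_id
  map_act _ _ := rfl
  proj_toFun _ := rfl
  ψ_toFun _ := rfl

def Hom.comp {P Q R : Bibundle X M} (k : Hom Q R) (f : Hom P Q) : Hom P R where
  toFun := fun p => k.toFun (f.toFun p)
  continuous_toFun := k.continuous_toFun.comp f.continuous_toFun
  map_act p g := by rw [f.map_act, k.map_act]
  proj_toFun p := by rw [k.proj_toFun, f.proj_toFun]
  ψ_toFun p := by rw [k.ψ_toFun, f.ψ_toFun]

/-- Every morphism of bibundles covering the identity is an isomorphism. -/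
theorem Hom.nonempty_iso {P Q : Bibundle X M} (f : Hom P Q) : Nonempty (Iso P Q) := by
  have hinj : Function.Injective f.toFun := by
    intro p q h
    have hp : P.proj p = P.proj q := by rw [← f.proj_toFun, h, f.proj_toFun]
    obtain ⟨g, rfl⟩ := P.exists_act_eq hp
    rw [f.map_act] at h
    have : (1 : G) = g := Q.act_injective (f.toFun p) (by rw [Q.act_one]; exact h)
    rw [← this, P.act_one]
  have hsurj : Function.Surjective f.toFun := by
    intro q
    obtain ⟨L⟩ := P.locallyTrivial.localData (Q.proj q)
    have : Q.proj (f.toFun (L.s ⟨_, L.mem⟩)) = Q.proj q := by rw [f.proj_toFun, L.proj_s]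
    obtain ⟨g, hg⟩ := Q.exists_act_eq this
    exact ⟨P.act (L.s ⟨_, L.mem⟩) g, by rw [f.map_act, hg]⟩
  let E := Equiv.ofBijective f.toFun ⟨hinj, hsurj⟩
  have hE : ∀ q, f.toFun (E.symm q) = q := fun q => E.apply_symm_apply q
  have hE' : ∀ p, E.symm (f.toFun p) = p := fun p => E.symm_apply_apply p
  have hact : ∀ q g, E.symm (Q.act q g) = P.act (E.symm q) g := fun q g => by
    apply hinj
    rw [hE, f.map_act, hE]
  refine ⟨⟨f, ⟨E.symm, ?_, hact, fun q => ?_, fun q => ?_⟩, hE', hE⟩⟩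
  · refine Q.continuous_of_sections P.continuous_act _ hact fun m => ?_
    obtain ⟨L⟩ := P.locallyTrivial.localData m
    refine ⟨L.U, L.isOpen, L.mem, fun v => f.toFun (L.s v),
      f.continuous_toFun.comp L.continuous_s, fun v => ?_, ?_⟩
    · rw [f.proj_toFun, L.proj_s]
    · simpa only [hE'] using L.continuous_s
  · rw [← f.proj_toFun, hE]
  · rw [← f.ψ_toFun, hE]

variable (X M) in
/-- The relation of being isomorphic. -/
def isoSetoid : Setoid (Bibundle X M) where
  r P Q := Nonempty (Iso P Q)
  iseqv :=
    { refl := fun P => (Hom.id P).nonempty_iso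
      symm := fun ⟨f⟩ => f.inv.nonempty_iso
      trans := fun ⟨f⟩ ⟨k⟩ => (k.hom.comp f.hom).nonempty_iso }

/-- The left action `g p = p (α (ψ p))⁻¹(g)` of `G` on a bibundle. -/
def leftAct (P : Bibundle X M) (g : G) (p : P.Total) : P.Total := P.act p (X.α (P.ψ p)⁻¹ g)

@[simp]
theorem proj_leftAct (P : Bibundle X M) (g : G) (p : P.Total) :
    P.proj (P.leftAct g p) = P.proj p := P.proj_act _ _

theorem ψ_leftAct (P : Bibundle X M) (g : G) (p : P.Total) :
    P.ψ (P.leftAct g p) = X.t g * P.ψ p := by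
  rw [leftAct, P.ψ_act, X.t_α, inv_inv]
  group

theorem leftAct_one (P : Bibundle X M) (p : P.Total) : P.leftAct 1 p = p := by
  simp [leftAct]

theorem leftAct_leftAct (P : Bibundle X M) (g k : G) (p : P.Total) :
    P.leftAct g (P.leftAct k p) = P.leftAct (g * k) p := by
  rw [leftAct, P.ψ_leftAct, X.α_inv_t_mul, leftAct, P.act_act, ← map_mul, leftAct]
  congr 2
  group

theorem leftAct_act (P : Bibundle X M) (g k : G) (p : P.Total) :
    P.leftAct g (P.act p k) = P.act (P.leftAct g p) k := by
  rw [leftAct, P.ψ_act, X.α_inv_mul_t, P.act_act, leftAct, P.act_act]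
  congr 1
  group

theorem continuous_leftAct (P : Bibundle X M) :
    Continuous fun x : G × P.Total => P.leftAct x.1 x.2 :=
  P.continuous_act.comp (continuous_snd.prodMk
    (X.continuous_α.comp (((P.continuous_ψ.comp continuous_snd).inv).prodMk continuous_fst)))

/-- The trivial bibundle `M × G`, with structure map `(m, g) ↦ t(g)`. -/
def trivial (X : CrossedModule H G) (M : Type u) [TopologicalSpace M] : Bibundle X M where
  Total := M × G
  act p g := (p.1, p.2 * g)
  act_one p := by simp
  act_act p g k := by simp [mul_assoc]
  continuous_act := by fun_prop
  proj := Prod.fst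
  continuous_proj := continuous_fst
  proj_act _ _ := rfl
  locallyTrivial := isLocallyTrivial_of_localData continuous_fst (by fun_prop) (fun _ _ => rfl)
    fun m => ⟨{ U := Set.univ
                isOpen := isOpen_univ
                mem := Set.mem_univ m
                s := fun v => (v, 1)
                d := Prod.snd
                continuous_s := by fun_prop
                proj_s := fun _ => rfl
                continuousOn_d := continuous_snd.continuousOn
                act_d := fun p _ => by simp
                d_act := fun _ _ _ => rfl }⟩
  ψ p := X.t p.2
  continuous_ψ := X.continuous_t.comp continuous_snd
  ψ_act p g := map_mul X.t p.2 g

/-- The pullback `f^* P = {(n, p) | f n = π(p)}` of a bibundle. -/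
def pullback {N : Type u} [TopologicalSpace N] (f : C(N, M)) (P : Bibundle X M) :
    Bibundle X N where
  Total := {x : N × P.Total // f x.1 = P.proj x.2}
  act x g := ⟨(x.1.1, P.act x.1.2 g), by rw [P.proj_act]; exact x.2⟩
  act_one x := by simp
  act_act x g k := by simp
  continuous_act := Continuous.subtype_mk ((by fun_prop : Continuous fun x :
      {x : N × P.Total // f x.1 = P.proj x.2} × G => x.1.1.1).prodMk
      (P.continuous_act.comp (by fun_prop : Continuous fun x :
      {x : N × P.Total // f x.1 = P.proj x.2} × G => (x.1.1.2, x.2)))) _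
  proj x := x.1.1
  continuous_proj := by fun_prop
  proj_act _ _ := rfl
  locallyTrivial := by
    refine isLocallyTrivial_of_localData (by fun_prop) (Continuous.subtype_mk ((by fun_prop :
      Continuous fun x : {x : N × P.Total // f x.1 = P.proj x.2} × G => x.1.1.1).prodMk
      (P.continuous_act.comp (by fun_prop : Continuous fun x :
      {x : N × P.Total // f x.1 = P.proj x.2} × G => (x.1.1.2, x.2)))) _) (fun _ _ => rfl)
      fun n => ?_
    obtain ⟨L⟩ := P.locallyTrivial.localData (f n)
    exact ⟨{ U := f ⁻¹' L.U
             isOpen := L.isOpen.preimage f.continuous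
             mem := L.mem
             s := fun v => ⟨(v, L.s ⟨f v, v.2⟩), by rw [L.proj_s]⟩
             d := fun x => L.d x.1.2
             continuous_s := Continuous.subtype_mk (continuous_subtype_val.prodMk
               (L.continuous_s.comp ((f.continuous.comp continuous_subtype_val).subtype_mk
                 fun v : f ⁻¹' L.U => v.2))) fun v => (L.proj_s ⟨f v, v.2⟩).symm
             proj_s := fun _ => rfl
             continuousOn_d := L.continuousOn_d.comp (by fun_prop) fun x hx => by
               change P.proj _ ∈ L.U
               rw [← x.2]; exact hx
             act_d := fun x hx => by
               have h : P.proj x.1.2 ∈ L.U := by rw [← x.2]; exact hx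
               have h1 := L.act_d x.1.2 h
               have h2 : (⟨f x.1.1, hx⟩ : L.U) = ⟨P.proj x.1.2, h⟩ := Subtype.ext x.2
               refine Subtype.ext (Prod.ext rfl ?_)
               change P.act (L.s ⟨f x.1.1, hx⟩) (L.d x.1.2) = x.1.2
               rw [h2, h1]
             d_act := fun x hx g => L.d_act x.1.2 (by rw [← x.2]; exact hx) g }⟩
  ψ x := P.ψ x.1.2
  continuous_ψ := P.continuous_ψ.comp (by fun_prop)
  ψ_act x g := P.ψ_act x.1.2 g

/-- The dual bibundle: the same space over `M`, with right action `p · g = g⁻¹ p` and structure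
map `p ↦ ψ(p)⁻¹`. -/
def dual (P : Bibundle X M) : Bibundle X M where
  Total := P.Total
  act p g := P.leftAct g⁻¹ p
  act_one p := by rw [inv_one, P.leftAct_one]
  act_act p g k := by rw [P.leftAct_leftAct, mul_inv_rev]
  continuous_act := P.continuous_leftAct.comp (by fun_prop :
    Continuous fun x : P.Total × G => (x.2⁻¹, x.1))
  proj := P.proj
  continuous_proj := P.continuous_proj
  proj_act p g := P.proj_leftAct _ _
  locallyTrivial := by
    refine isLocallyTrivial_of_localData P.continuous_proj (P.continuous_leftAct.comp (by fun_prop :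
      Continuous fun x : P.Total × G => (x.2⁻¹, x.1))) (fun p g => P.proj_leftAct _ _) fun m => ?_
    obtain ⟨L⟩ := P.locallyTrivial.localData m
    have hψ : ∀ (p : P.Total) (hp : P.proj p ∈ L.U),
        P.ψ p = P.ψ (L.s ⟨P.proj p, hp⟩) * X.t (L.d p) := fun p hp => by
      rw [← P.ψ_act, L.act_d p hp]
    refine ⟨{ U := L.U
              isOpen := L.isOpen
              mem := L.mem
              s := L.s
              d := fun p => (X.α (P.ψ p * X.t (L.d p)⁻¹) (L.d p))⁻¹
              continuous_s := L.continuous_s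
              proj_s := L.proj_s
              continuousOn_d := ?_
              act_d := ?_
              d_act := ?_ }⟩
    · have h1 : ContinuousOn (fun p => P.ψ p * X.t (L.d p)⁻¹) (P.proj ⁻¹' L.U) :=
        P.continuous_ψ.continuousOn.mul
          (X.continuous_t.comp_continuousOn L.continuousOn_d.inv)
      exact (X.continuous_α.comp_continuousOn (h1.prodMk L.continuousOn_d)).inv
    · intro p hp
      have h1 : P.ψ p * X.t (L.d p)⁻¹ = P.ψ (L.s ⟨P.proj p, hp⟩) := by
        rw [hψ p hp, map_inv, mul_inv_cancel_right]
      change P.leftAct _ _ = p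
      rw [h1, inv_inv, leftAct, X.α_inv_α, L.act_d p hp]
    · intro p hp g
      have h2 : L.d (P.leftAct g⁻¹ p) = L.d p * X.α (P.ψ p)⁻¹ g⁻¹ := L.d_act p hp _
      have h3 : P.ψ (P.leftAct g⁻¹ p) * X.t (L.d (P.leftAct g⁻¹ p))⁻¹
          = P.ψ p * X.t (L.d p)⁻¹ := by
        rw [h2, leftAct, P.ψ_act, mul_inv_rev, map_mul, map_inv X.t (X.α _ _), mul_assoc,
          mul_inv_cancel_left]
      have h4 : X.α (P.ψ p * X.t (L.d p)⁻¹) (X.α (P.ψ p)⁻¹ g⁻¹)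
          = (X.α (P.ψ p * X.t (L.d p)⁻¹) (L.d p))⁻¹ * g⁻¹
            * X.α (P.ψ p * X.t (L.d p)⁻¹) (L.d p) := by
        have h5 : (P.ψ p)⁻¹ = ((P.ψ p * X.t (L.d p)⁻¹) * X.t (L.d p))⁻¹ := by
          rw [map_inv, inv_mul_cancel_right]
        rw [h5, X.α_inv_mul_t, map_mul, map_mul, X.α_α_inv, map_inv (X.α _)]
      rw [h3, h2, map_mul, h4]
      group
  ψ p := (P.ψ p)⁻¹
  continuous_ψ := P.continuous_ψ.inv
  ψ_act p g := by rw [P.ψ_leftAct, map_inv, mul_inv_rev, inv_inv]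

/-- The relation `(p, q) ∼ (p g, g⁻¹ q)` on `P ×_M Q`. -/
def tensorSetoid (P Q : Bibundle X M) :
    Setoid {x : P.Total × Q.Total // P.proj x.1 = Q.proj x.2} where
  r x y := ∃ g : G, y.1 = (P.act x.1.1 g, Q.leftAct g⁻¹ x.1.2)
  iseqv :=
    { refl := fun x => ⟨1, by rw [P.act_one, inv_one, Q.leftAct_one]⟩
      symm := fun {x y} ⟨g, h⟩ => ⟨g⁻¹, by
        rw [h, P.act_act, Q.leftAct_leftAct, mul_inv_cancel, inv_inv, mul_inv_cancel, P.act_one,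
          Q.leftAct_one]⟩
      trans := fun {x y z} ⟨g, h⟩ ⟨k, h'⟩ => ⟨g * k, by
        rw [h', h, P.act_act, Q.leftAct_leftAct, mul_inv_rev]⟩ }

/-- The total space `(P ×_M Q) / G` of the tensor product, with the quotient topology. -/
abbrev TensorTotal (P Q : Bibundle X M) : Type u := Quotient (tensorSetoid P Q)

/-- The class `p ⊗ q`. -/
def tmul {P Q : Bibundle X M} (p : P.Total) (q : Q.Total) (h : P.proj p = Q.proj q) :
    TensorTotal P Q := Quotient.mk (tensorSetoid P Q) ⟨(p, q), h⟩

theorem tmul_act {P Q : Bibundle X M} (p : P.Total) (q : Q.Total) (g : G)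
    (h : P.proj (P.act p g) = Q.proj q) :
    tmul (P.act p g) q h = tmul p (Q.leftAct g q) (by simpa using h) := by
  refine Quotient.sound (s := tensorSetoid P Q) ⟨g⁻¹, ?_⟩
  simp [P.act_one]

theorem tensor_ind {P Q : Bibundle X M} {C : TensorTotal P Q → Prop}
    (h : ∀ p q (hpq : P.proj p = Q.proj q), C (tmul p q hpq)) (z : TensorTotal P Q) : C z :=
  Quotient.inductionOn z fun x => h x.1.1 x.1.2 x.2

/-- Functions out of the tensor product. -/
def tensorLift {P Q : Bibundle X M} {Z : Type*}
    (f : ∀ (p : P.Total) (q : Q.Total), P.proj p = Q.proj q → Z)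
    (hf : ∀ (p : P.Total) (q : Q.Total) (g : G) (h : P.proj p = Q.proj q)
      (h' : P.proj (P.act p g) = Q.proj (Q.leftAct g⁻¹ q)),
      f p q h = f (P.act p g) (Q.leftAct g⁻¹ q) h') (z : TensorTotal P Q) : Z :=
  Quotient.lift (fun x : {x : P.Total × Q.Total // P.proj x.1 = Q.proj x.2} => f x.1.1 x.1.2 x.2)
    (by
      rintro ⟨⟨p, q⟩, h⟩ ⟨⟨p', q'⟩, h'⟩ ⟨g, hg⟩
      obtain ⟨rfl, rfl⟩ := Prod.mk.inj hg
      exact hf p q g h h') z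

theorem continuous_tmul {P Q : Bibundle X M} {Y : Type*} [TopologicalSpace Y]
    {a : Y → P.Total} {b : Y → Q.Total} (ha : Continuous a) (hb : Continuous b)
    (h : ∀ y, P.proj (a y) = Q.proj (b y)) : Continuous fun y => tmul (a y) (b y) (h y) :=
  (continuous_quotient_mk' (s := tensorSetoid P Q)).comp ((ha.prodMk hb).subtype_mk h)

theorem continuous_tensorLift {P Q : Bibundle X M} {Z : Type*} [TopologicalSpace Z]
    {f : ∀ (p : P.Total) (q : Q.Total), P.proj p = Q.proj q → Z} (hf)
    (h : Continuous fun x : {x : P.Total × Q.Total // P.proj x.1 = Q.proj x.2} =>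
      f x.1.1 x.1.2 x.2) : Continuous (tensorLift f hf) :=
  Continuous.quotient_lift (s := tensorSetoid P Q) h _

/-- The right action `(p ⊗ q) g = p ⊗ q g`. -/
def tensorAct (P Q : Bibundle X M) (z : TensorTotal P Q) (g : G) : TensorTotal P Q :=
  tensorLift (fun p q h => tmul p (Q.act q g) (by rw [h, Q.proj_act])) (fun p q k h h' =>
    Quotient.sound (s := tensorSetoid P Q) ⟨k, by rw [Q.leftAct_act]⟩) z

/-- The projection `p ⊗ q ↦ π(p) = π(q)`. -/
def tensorProj (P Q : Bibundle X M) : TensorTotal P Q → M :=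
  tensorLift (fun p _ _ => P.proj p) (fun p _ k _ _ => (P.proj_act p k).symm)

/-- The structure map `p ⊗ q ↦ ψ(p) ψ(q)`. -/
def tensorψ (P Q : Bibundle X M) : TensorTotal P Q → H :=
  tensorLift (fun p q _ => P.ψ p * Q.ψ q) (fun p q k h h' => by
    rw [P.ψ_act, Q.ψ_leftAct, map_inv]; group)

theorem continuous_tensorAct (P Q : Bibundle X M) :
    Continuous fun x : TensorTotal P Q × G => tensorAct P Q x.1 x.2 := by
  have hq : IsOpenQuotientMap
      (Quotient.mk (tensorSetoid P Q) : _ → TensorTotal P Q) := by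
    refine ⟨Quotient.mk_surjective, continuous_quotient_mk', fun V hV => ?_⟩
    have : Quotient.mk (tensorSetoid P Q) ⁻¹' (Quotient.mk (tensorSetoid P Q) '' V)
        = ⋃ g : G, {x | (⟨(P.act x.1.1 g, Q.leftAct g⁻¹ x.1.2), by
            rw [P.proj_act, Q.proj_leftAct]; exact x.2⟩ :
            {x : P.Total × Q.Total // P.proj x.1 = Q.proj x.2}) ∈ V} := by
      ext x
      simp only [Set.mem_preimage, Set.mem_image, Set.mem_iUnion, Set.mem_ofPred_eq]
      constructor
      · rintro ⟨y, hy, hxy⟩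
        obtain ⟨g, hg⟩ := Quotient.exact hxy.symm
        refine ⟨g, ?_⟩
        convert hy using 1
        exact Subtype.ext hg.symm
      · rintro ⟨g, hg⟩
        exact ⟨_, hg, (Quotient.sound ⟨g, rfl⟩ : Quotient.mk (tensorSetoid P Q) x = _).symm⟩
    change IsOpen (Quotient.mk (tensorSetoid P Q) ⁻¹' _)
    rw [this]
    refine isOpen_iUnion fun g => hV.preimage ?_
    exact ((P.continuous_act.comp (by fun_prop : Continuous fun x :
      {x : P.Total × Q.Total // P.proj x.1 = Q.proj x.2} => (x.1.1, g))).prodMk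
      (Q.continuous_leftAct.comp (by fun_prop : Continuous fun x :
      {x : P.Total × Q.Total // P.proj x.1 = Q.proj x.2} => (g⁻¹, x.1.2)))).subtype_mk _
  have hq' := (hq.prodMap (IsOpenQuotientMap.id (X := G))).isQuotientMap
  rw [hq'.continuous_iff]
  exact continuous_tmul (P := P) (Q := Q)
    (Y := {x : P.Total × Q.Total // P.proj x.1 = Q.proj x.2} × G)
    (a := fun x => x.1.1.1) (b := fun x => Q.act x.1.1.2 x.2) (by fun_prop)
    (Q.continuous_act.comp (by fun_prop : Continuous fun x :
      {x : P.Total × Q.Total // P.proj x.1 = Q.proj x.2} × G => (x.1.1.2, x.2)))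
    (fun x => by rw [Q.proj_act]; exact x.1.2)

theorem continuous_tensorProj (P Q : Bibundle X M) : Continuous (tensorProj P Q) :=
  continuous_tensorLift _ (P.continuous_proj.comp (by fun_prop))

theorem tensorProj_act (P Q : Bibundle X M) (z : TensorTotal P Q) (g : G) :
    tensorProj P Q (tensorAct P Q z g) = tensorProj P Q z := by
  induction z using tensor_ind
  rfl

/-- Local data of a tensor product: the section `s ⊗ r` built from sections `s` and `r`. -/
theorem exists_tensor_localData (P Q : Bibundle X M) (m : M) :
    Nonempty (LocalData (tensorProj P Q) (tensorAct P Q) m) := by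
  obtain ⟨L⟩ := P.locallyTrivial.localData m
  obtain ⟨K⟩ := Q.locallyTrivial.localData m
  let F : {x : P.Total × Q.Total // P.proj x.1 = Q.proj x.2} → G := fun x =>
    K.d x.1.2 * X.α (Q.ψ x.1.2)⁻¹ (L.d x.1.1)
  have hF : ∀ x y : {x : P.Total × Q.Total // P.proj x.1 = Q.proj x.2},
      P.proj x.1.1 ∈ L.U ∩ K.U → tensorSetoid P Q x y → F x = F y := by
    rintro ⟨⟨p, q⟩, h⟩ ⟨⟨p', q'⟩, h'⟩ hx ⟨g, hg⟩
    obtain ⟨rfl, rfl⟩ := Prod.mk.inj hg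
    have hk : Q.proj q ∈ K.U := by
      have : P.proj p = Q.proj q := h
      rw [← this]; exact hx.2
    change K.d q * X.α (Q.ψ q)⁻¹ (L.d p)
      = K.d (Q.leftAct g⁻¹ q) * X.α (Q.ψ (Q.leftAct g⁻¹ q))⁻¹ (L.d (P.act p g))
    rw [L.d_act p hx.1, Q.ψ_leftAct, X.α_inv_t_mul, leftAct, K.d_act q hk, mul_assoc, ← map_mul]
    congr 2
    group
  let D : TensorTotal P Q → G := fun z => F z.out
  have hD : ∀ x : {x : P.Total × Q.Total // P.proj x.1 = Q.proj x.2},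
      P.proj x.1.1 ∈ L.U ∩ K.U → D (Quotient.mk _ x) = F x := fun x hx =>
    (hF x _ hx ((tensorSetoid P Q).symm (Quotient.mk_out (s := tensorSetoid P Q) x))).symm
  refine ⟨{ U := L.U ∩ K.U
            isOpen := L.isOpen.inter K.isOpen
            mem := ⟨L.mem, K.mem⟩
            s := fun v => tmul (L.s ⟨v, v.2.1⟩) (K.s ⟨v, v.2.2⟩) (by rw [L.proj_s, K.proj_s])
            d := D
            continuous_s := ?_
            proj_s := fun v => L.proj_s ⟨v, v.2.1⟩
            continuousOn_d := ?_
            act_d := ?_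
            d_act := ?_ }⟩
  · exact continuous_tmul
      (L.continuous_s.comp (continuous_subtype_val.subtype_mk fun v : (L.U ∩ K.U : Set M) => v.2.1))
      (K.continuous_s.comp (continuous_subtype_val.subtype_mk fun v : (L.U ∩ K.U : Set M) => v.2.2))
      _
  · have hqm : IsQuotientMap (Quotient.mk (tensorSetoid P Q)) := isQuotientMap_quotient_mk'
    rw [hqm.continuousOn_isOpen_iff
      ((L.isOpen.inter K.isOpen).preimage (continuous_tensorProj P Q))]
    have hc : ContinuousOn F
        (Quotient.mk (tensorSetoid P Q) ⁻¹' (tensorProj P Q ⁻¹' (L.U ∩ K.U))) := by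
      have h1 : ContinuousOn (fun x : {x : P.Total × Q.Total // P.proj x.1 = Q.proj x.2} =>
          L.d x.1.1) (Quotient.mk (tensorSetoid P Q) ⁻¹' (tensorProj P Q ⁻¹' (L.U ∩ K.U))) :=
        L.continuousOn_d.comp (by fun_prop) fun x hx => hx.1
      have h2 : ContinuousOn (fun x : {x : P.Total × Q.Total // P.proj x.1 = Q.proj x.2} =>
          K.d x.1.2) (Quotient.mk (tensorSetoid P Q) ⁻¹' (tensorProj P Q ⁻¹' (L.U ∩ K.U))) :=
        K.continuousOn_d.comp (by fun_prop) fun x hx => by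
          change Q.proj _ ∈ K.U
          rw [← x.2]; exact hx.2
      have h3 : Continuous (fun x : {x : P.Total × Q.Total // P.proj x.1 = Q.proj x.2} =>
          (Q.ψ x.1.2)⁻¹) := (Q.continuous_ψ.comp (by fun_prop)).inv
      exact h2.mul (X.continuous_α.comp_continuousOn (h3.continuousOn.prodMk h1))
    exact hc.congr fun x hx => hD x hx
  · intro z
    induction z using tensor_ind with
    | h p q h =>
      intro hz
      have hp : P.proj p ∈ L.U ∩ K.U := hz
      have hq : Q.proj q ∈ K.U := h ▸ hp.2
      have h1 : D (tmul p q h) = F ⟨(p, q), h⟩ := hD ⟨(p, q), h⟩ hp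
      rw [h1]
      change tmul (L.s ⟨P.proj p, hp.1⟩)
        (Q.act (K.s ⟨P.proj p, hp.2⟩) (K.d q * X.α (Q.ψ q)⁻¹ (L.d p))) _ = tmul p q h
      have h2 : (⟨P.proj p, hp.2⟩ : K.U) = ⟨Q.proj q, hq⟩ := Subtype.ext h
      have h3 : Q.act (K.s ⟨P.proj p, hp.2⟩) (K.d q * X.α (Q.ψ q)⁻¹ (L.d p))
          = Q.leftAct (L.d p) q := by
        rw [← Q.act_act, h2, K.act_d q hq, leftAct]
      refine Quotient.sound (s := tensorSetoid P Q) ⟨L.d p, ?_⟩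
      refine Prod.ext (L.act_d p hp.1).symm ?_
      change q = Q.leftAct _ (Q.act _ _)
      rw [h3, Q.leftAct_leftAct, inv_mul_cancel, Q.leftAct_one]
  · intro z
    induction z using tensor_ind with
    | h p q h =>
      intro hz g
      have hp : P.proj p ∈ L.U ∩ K.U := hz
      have hq : Q.proj q ∈ K.U := h ▸ hp.2
      have h1 : D (tmul p q h) = F ⟨(p, q), h⟩ := hD ⟨(p, q), h⟩ hp
      have h2 : D (tensorAct P Q (tmul p q h) g)
          = F ⟨(p, Q.act q g), by rw [Q.proj_act]; exact h⟩ := hD ⟨(p, Q.act q g), _⟩ hp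
      rw [h1, h2]
      change K.d (Q.act q g) * X.α (Q.ψ (Q.act q g))⁻¹ (L.d p)
        = K.d q * X.α (Q.ψ q)⁻¹ (L.d p) * g
      rw [K.d_act q hq, Q.ψ_act, X.α_inv_mul_t]
      group

/-- The tensor product `P ⊗ Q = (P ×_M Q) / G` of bibundles. -/
def tensor (P Q : Bibundle X M) : Bibundle X M where
  Total := TensorTotal P Q
  act := tensorAct P Q
  act_one z := by
    induction z using tensor_ind with
    | h p q h =>
      change tmul p (Q.act q 1) _ = tmul p q h
      congr 1
      exact Q.act_one q
  act_act z g k := by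
    induction z using tensor_ind with
    | h p q h =>
      change tmul p (Q.act (Q.act q g) k) _ = tmul p (Q.act q (g * k)) _
      congr 1
      exact Q.act_act q g k
  continuous_act := continuous_tensorAct P Q
  proj := tensorProj P Q
  continuous_proj := continuous_tensorProj P Q
  proj_act := tensorProj_act P Q
  locallyTrivial := isLocallyTrivial_of_localData (continuous_tensorProj P Q)
    (continuous_tensorAct P Q) (tensorProj_act P Q) (exists_tensor_localData P Q)
  ψ := tensorψ P Q
  continuous_ψ := continuous_tensorLift _
    ((P.continuous_ψ.comp (by fun_prop)).mul (Q.continuous_ψ.comp (by fun_prop)))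
  ψ_act z g := by
    induction z using tensor_ind with
    | h p q h =>
      change P.ψ p * Q.ψ (Q.act q g) = P.ψ p * Q.ψ q * X.t g
      rw [Q.ψ_act, mul_assoc]

/-! ### The group of isomorphism classes -/

theorem Hom.map_leftAct {P Q : Bibundle X M} (f : Hom P Q) (g : G) (p : P.Total) :
    f.toFun (P.leftAct g p) = Q.leftAct g (f.toFun p) := by
  rw [leftAct, f.map_act, leftAct, f.ψ_toFun]

/-- The tensor product of morphisms. -/
def Hom.tensor {P P' Q Q' : Bibundle X M} (f : Hom P P') (k : Hom Q Q') :
    Hom (P.tensor Q) (P'.tensor Q') where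
  toFun := tensorLift (Z := (P'.tensor Q').Total)
    (fun p q h => tmul (f.toFun p) (k.toFun q) (by rw [f.proj_toFun, k.proj_toFun, h]))
    (fun p q g h h' => Quotient.sound (s := tensorSetoid P' Q')
      ⟨g, Prod.ext (f.map_act p g) (k.map_leftAct g⁻¹ q)⟩)
  continuous_toFun := continuous_tensorLift _
    (continuous_tmul (Y := {x : P.Total × Q.Total // P.proj x.1 = Q.proj x.2})
      (a := fun x => f.toFun x.1.1) (b := fun x => k.toFun x.1.2)
      (f.continuous_toFun.comp (by fun_prop)) (k.continuous_toFun.comp (by fun_prop))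
      fun x => (f.proj_toFun x.1.1).trans (x.2.trans (k.proj_toFun x.1.2).symm))
  map_act z g := by
    induction z using tensor_ind with
    | h p q h =>
      change tmul (f.toFun p) (k.toFun (Q.act q g)) _ = tmul (f.toFun p) (Q'.act (k.toFun q) g) _
      congr 1
      exact k.map_act q g
  proj_toFun z := by
    induction z using tensor_ind with
    | h p q h => exact f.proj_toFun p
  ψ_toFun z := by
    induction z using tensor_ind with
    | h p q h =>
      change P'.ψ (f.toFun p) * Q'.ψ (k.toFun q) = P.ψ p * Q.ψ q
      rw [f.ψ_toFun, k.ψ_toFun]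

theorem leftAct_tmul {P Q : Bibundle X M} (g : G) (p : P.Total) (q : Q.Total)
    (h : P.proj p = Q.proj q) :
    (P.tensor Q).leftAct g (tmul p q h) = tmul (P.leftAct g p) q (by simpa using h) := by
  have h1 := tmul_act (P := P) (Q := Q) p q (X.α (P.ψ p)⁻¹ g) (by simpa using h)
  refine Eq.trans ?_ h1.symm
  change tmul p (Q.act q (X.α (P.ψ p * Q.ψ q)⁻¹ g)) _ = _
  congr 1
  rw [mul_inv_rev, map_mul, MulAut.mul_apply, leftAct]

/-- The map `(p ⊗ q, r) ↦ p ⊗ (q ⊗ r)`. -/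
noncomputable def assocAux {P Q R : Bibundle X M} (w : (P.tensor Q).Total) (r : R.Total)
    (h : (P.tensor Q).proj w = R.proj r) : (P.tensor (Q.tensor R)).Total :=
  have h1 : P.proj (Quotient.out w).1.1 = R.proj r := by
    rw [← h]
    exact congrArg (P.tensor Q).proj (Quotient.out_eq w)
  tmul (P := P) (Q := Q.tensor R) (Quotient.out w).1.1
    (tmul (Quotient.out w).1.2 r ((Quotient.out w).2.symm.trans h1))
    (Quotient.out w).2

theorem assocAux_tmul {P Q R : Bibundle X M} (p : P.Total) (q : Q.Total) (r : R.Total)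
    (h : P.proj p = Q.proj q) (h' : Q.proj q = R.proj r) :
    assocAux (P := P) (Q := Q) (tmul p q h) r (h.trans h')
      = tmul (P := P) (Q := Q.tensor R) p (tmul q r h') h := by
  have key : ∀ y : {x : P.Total × Q.Total // P.proj x.1 = Q.proj x.2},
      tensorSetoid P Q ⟨(p, q), h⟩ y → ∀ hy : Q.proj y.1.2 = R.proj r,
      tmul (P := P) (Q := Q.tensor R) y.1.1 (tmul y.1.2 r hy) y.2
        = tmul (P := P) (Q := Q.tensor R) p (tmul q r h') h := by
    rintro ⟨⟨p', q'⟩, hy'⟩ ⟨g, hg⟩ hy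
    obtain ⟨rfl, rfl⟩ := Prod.mk.inj hg
    refine (tmul_act (P := P) (Q := Q.tensor R) p (tmul (Q.leftAct g⁻¹ q) r hy) g hy').trans ?_
    congr 1
    refine (leftAct_tmul g _ r _).trans ?_
    congr 1
    rw [Q.leftAct_leftAct, mul_inv_cancel, Q.leftAct_one]
  exact key _ ((tensorSetoid P Q).symm (Quotient.mk_out (s := tensorSetoid P Q) ⟨(p, q), h⟩)) _

/-- The associativity morphism. -/
noncomputable def assocHom (P Q R : Bibundle X M) :
    Hom ((P.tensor Q).tensor R) (P.tensor (Q.tensor R)) :=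
  let F : ((P.tensor Q).tensor R).Total → (P.tensor (Q.tensor R)).Total :=
    tensorLift (P := P.tensor Q) (Q := R) assocAux (by
      intro w r g h h'
      induction w using tensor_ind with
      | h p q hpq =>
        have hq : Q.proj q = R.proj r := hpq.symm.trans h
        refine (assocAux_tmul p q r hpq hq).trans
          (Eq.trans ?_ (assocAux_tmul p (Q.act q g) (R.leftAct g⁻¹ r) (by rw [hpq, Q.proj_act])
            (by rw [Q.proj_act, hq, R.proj_leftAct])).symm)
        congr 1
        rw [tmul_act]
        congr 1
        rw [R.leftAct_leftAct, mul_inv_cancel, R.leftAct_one])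
  have hF : ∀ (p : P.Total) (q : Q.Total) (r : R.Total) (h : P.proj p = Q.proj q)
      (h' : Q.proj q = R.proj r),
      F (tmul (P := P.tensor Q) (Q := R) (tmul p q h) r (h.trans h'))
        = tmul (P := P) (Q := Q.tensor R) p (tmul q r h') h := fun p q r h h' =>
    assocAux_tmul p q r h h'
  have hact : ∀ z g, F (((P.tensor Q).tensor R).act z g) = (P.tensor (Q.tensor R)).act (F z) g := by
    intro z g
    induction z using tensor_ind with
    | h w r h =>
      induction w using tensor_ind with
      | h p q hpq =>
        have hq : Q.proj q = R.proj r := hpq.symm.trans h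
        refine (hF p q (R.act r g) hpq (by rw [R.proj_act, hq])).trans ?_
        exact (congrArg (fun z => (P.tensor (Q.tensor R)).act z g) (hF p q r hpq hq)).symm
  { toFun := F
    continuous_toFun := by
      refine PrincipalBundle.continuous_of_sections _ (P.tensor (Q.tensor R)).continuous_act
        F hact fun m => ?_
      obtain ⟨L⟩ := P.locallyTrivial.localData m
      obtain ⟨K⟩ := Q.locallyTrivial.localData m
      obtain ⟨J⟩ := R.locallyTrivial.localData m
      let V : Set M := L.U ∩ K.U ∩ J.U
      let l : V → P.Total := fun v => L.s ⟨v, v.2.1.1⟩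
      let k : V → Q.Total := fun v => K.s ⟨v, v.2.1.2⟩
      let j : V → R.Total := fun v => J.s ⟨v, v.2.2⟩
      have cl : Continuous l := L.continuous_s.comp (continuous_subtype_val.subtype_mk _)
      have ck : Continuous k := K.continuous_s.comp (continuous_subtype_val.subtype_mk _)
      have cj : Continuous j := J.continuous_s.comp (continuous_subtype_val.subtype_mk _)
      have hlk : ∀ v, P.proj (l v) = Q.proj (k v) := fun v => by
        change P.proj (L.s _) = Q.proj (K.s _); rw [L.proj_s, K.proj_s]
      have hkj : ∀ v, Q.proj (k v) = R.proj (j v) := fun v => by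
        change Q.proj (K.s _) = R.proj (J.s _); rw [K.proj_s, J.proj_s]
      refine ⟨V, (L.isOpen.inter K.isOpen).inter J.isOpen, ⟨⟨L.mem, K.mem⟩, J.mem⟩,
        fun v => tmul (P := P.tensor Q) (Q := R) (tmul (l v) (k v) (hlk v)) (j v)
          ((hlk v).trans (hkj v)), ?_, fun v => L.proj_s _, ?_⟩
      · exact continuous_tmul (P := P.tensor Q) (Q := R) (continuous_tmul cl ck hlk) cj _
      · simp only [hF _ _ _ (hlk _) (hkj _)]
        exact continuous_tmul (P := P) (Q := Q.tensor R) cl (continuous_tmul ck cj hkj) hlk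
    map_act := hact
    proj_toFun := by
      intro z
      induction z using tensor_ind with
      | h w r h =>
        induction w using tensor_ind with
        | h p q hpq =>
          exact congrArg (P.tensor (Q.tensor R)).proj (hF p q r hpq (hpq.symm.trans h))
    ψ_toFun := by
      intro z
      induction z using tensor_ind with
      | h w r h =>
        induction w using tensor_ind with
        | h p q hpq =>
          refine (congrArg (P.tensor (Q.tensor R)).ψ (hF p q r hpq (hpq.symm.trans h))).trans ?_
          exact (mul_assoc (P.ψ p) (Q.ψ q) (R.ψ r)).symm }

/-- The left unit morphism `(m, g) ⊗ p ↦ g p`. -/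
def unitHom (P : Bibundle X M) : Hom ((trivial X M).tensor P) P where
  toFun := tensorLift (P := trivial X M) (Q := P) (fun x p _ => P.leftAct x.2 p)
    (fun x p g h h' => by
      change P.leftAct x.2 p = P.leftAct (x.2 * g) (P.leftAct g⁻¹ p)
      rw [P.leftAct_leftAct, mul_inv_cancel_right])
  continuous_toFun := continuous_tensorLift (P := trivial X M) (Q := P) _
    (P.continuous_leftAct.comp (by fun_prop : Continuous fun x :
      {x : (M × G) × P.Total // x.1.1 = P.proj x.2} => (x.1.1.2, x.1.2)))
  map_act z g := by
    induction z using tensor_ind with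
    | h x p h => exact P.leftAct_act x.2 g p
  proj_toFun z := by
    induction z using tensor_ind with
    | h x p h => exact (P.proj_leftAct x.2 p).trans h.symm
  ψ_toFun z := by
    induction z using tensor_ind with
    | h x p h => exact P.ψ_leftAct x.2 p

/-- The morphism from `P^* ⊗ P` to the trivial bibundle sending `p ⊗ p g` to `g`. -/
noncomputable def dualHom (P : Bibundle X M) : Hom (P.dual.tensor P) (trivial X M) :=
  have hτ : ∀ p q : P.Total, P.proj p = P.proj q → ∃ g, P.act p g = q :=
    fun p q h => P.exists_act_eq h
  have hinv : ∀ (p q : P.Total) (g k k' : G), P.act p k = q →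
      P.act (P.leftAct g⁻¹ p) k' = P.leftAct g⁻¹ q → k = k' := by
    intro p q g k k' h1 h2
    apply P.act_injective p
    have h3 := congrArg (P.leftAct g) h2
    rw [P.leftAct_act, P.leftAct_leftAct, P.leftAct_leftAct, mul_inv_cancel, P.leftAct_one,
      P.leftAct_one] at h3
    exact h1.trans h3.symm
  let F : (P.dual.tensor P).Total → (trivial X M).Total :=
    tensorLift (P := P.dual) (Q := P) (Z := M × G)
      (fun p q h => (P.proj p, Classical.choose (hτ p q h))) (by
        intro p q g h h'
        refine Prod.ext (P.proj_leftAct g⁻¹ p).symm ?_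
        exact hinv p q g _ _ (Classical.choose_spec (hτ p q h))
          (Classical.choose_spec (hτ (P.leftAct g⁻¹ p) (P.leftAct g⁻¹ q) h')))
  have hF : ∀ (p q : P.Total) (g : G) (h : P.proj p = P.proj q), P.act p g = q →
      F (tmul (P := P.dual) (Q := P) p q h) = (P.proj p, g) := fun p q g h hg =>
    Prod.ext rfl (P.act_injective p ((Classical.choose_spec (hτ p q h)).trans hg.symm))
  have hact : ∀ z g, F ((P.dual.tensor P).act z g) = (trivial X M).act (F z) g := by
    intro z g
    induction z using tensor_ind with
    | h p q h =>
      obtain ⟨k, hk⟩ := hτ p q h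
      refine (hF p (P.act q g) (k * g) (h.trans (P.proj_act q g).symm)
        ((P.act_act p k g).symm.trans (congrArg (fun z => P.act z g) hk))).trans ?_
      exact (congrArg (fun z => (trivial X M).act z g) (hF p q k h hk)).symm
  { toFun := F
    continuous_toFun := by
      refine PrincipalBundle.continuous_of_sections _ (trivial X M).continuous_act
        F hact fun m => ?_
      obtain ⟨L⟩ := P.locallyTrivial.localData m
      refine ⟨L.U, L.isOpen, L.mem, fun v => tmul (P := P.dual) (Q := P) (L.s v) (L.s v) rfl,
        continuous_tmul (P := P.dual) (Q := P) L.continuous_s L.continuous_s _,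
        fun v => L.proj_s v, ?_⟩
      have : (fun v => F (tmul (P := P.dual) (Q := P) (L.s v) (L.s v) rfl))
          = fun v : L.U => ((v : M), (1 : G)) := by
        funext v
        rw [hF _ _ 1 rfl (P.act_one _), L.proj_s]
      rw [this]
      exact continuous_subtype_val.prodMk continuous_const
    map_act := hact
    proj_toFun := by
      intro z
      induction z using tensor_ind with
      | h p q h => rfl
    ψ_toFun := by
      intro z
      induction z using tensor_ind with
      | h p q h =>
        obtain ⟨k, hk⟩ := hτ p q h
        refine (congrArg (trivial X M).ψ (hF p q k h hk)).trans ?_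
        change X.t k = (P.ψ p)⁻¹ * P.ψ q
        exact eq_inv_mul_of_mul_eq ((P.ψ_act p k).symm.trans (congrArg P.ψ hk)) }

variable (X M) in
/-- The set `π₀ Bibun_{(H,G)}(M)` of isomorphism classes of `(H, G)`-bibundles on `M`. -/
def Pi0 : Type (u + 1) := Quotient (isoSetoid X M)

/-- The isomorphism class of a bibundle. -/
def isoClass (P : Bibundle X M) : Pi0 X M := Quotient.mk (isoSetoid X M) P

theorem isoClass_eq_of_hom {P Q : Bibundle X M} (f : Hom P Q) : P.isoClass = Q.isoClass :=
  Quotient.sound (s := isoSetoid X M) f.nonempty_iso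

/-- The product on `π₀ Bibun_{(H,G)}(M)` is `[P][Q] = [P ⊗ Q]`. -/
instance : Mul (Pi0 X M) where
  mul := Quotient.map₂ tensor fun _ _ ⟨f⟩ _ _ ⟨k⟩ => (f.hom.tensor k.hom).nonempty_iso

instance : One (Pi0 X M) where
  one := (trivial X M).isoClass

/-- The morphism `P^* → Q^*` induced by a morphism `P → Q`. -/
def Hom.dual {P Q : Bibundle X M} (f : Hom P Q) : Hom P.dual Q.dual where
  toFun := f.toFun
  continuous_toFun := f.continuous_toFun
  map_act p g := f.map_leftAct g⁻¹ p
  proj_toFun := f.proj_toFun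
  ψ_toFun p := congrArg (·⁻¹) (f.ψ_toFun p)

/-- The inverse on `π₀ Bibun_{(H,G)}(M)` is `[P]⁻¹ = [P^*]`. -/
instance : Inv (Pi0 X M) where
  inv := Quotient.map Bibundle.dual fun _ _ ⟨f⟩ => f.hom.dual.nonempty_iso

instance : Group (Pi0 X M) :=
  Group.ofLeftAxioms
    (by
      rintro ⟨P⟩ ⟨Q⟩ ⟨R⟩
      exact isoClass_eq_of_hom (assocHom P Q R))
    (by
      rintro ⟨P⟩
      exact isoClass_eq_of_hom (unitHom P))
    (by
      rintro ⟨P⟩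
      exact isoClass_eq_of_hom (dualHom P))

end Bibundle

/-! ## The universal bibundle `E(H, G) → B(H, G)` -/

/-- The semidirect product carries the topology of the product `N × K`. -/
instance SemidirectProduct.instTopologicalSpace {N K : Type*} [Group N] [Group K]
    [TopologicalSpace N] [TopologicalSpace K] (φ : K →* MulAut N) :
    TopologicalSpace (N ⋊[φ] K) :=
  TopologicalSpace.induced (fun x : N ⋊[φ] K => (x.left, x.right)) inferInstance

/-- The topological group `EG` as a model, adapted to the crossed module `(H, G)`, for the total
space of the universal `G`-bundle: `EG` contains `G` as a closed subgroup, `EG → EG / G` is a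
principal `G`-bundle with contractible total space, and the action of `H` on `G` extends to an
action on `EG` by automorphisms such that `t(g)` acts as conjugation by `g`. -/
structure UniversalGroup {H G : Type u} [Group H] [TopologicalSpace H] [Group G]
    [TopologicalSpace G] (X : CrossedModule H G) (EG : Type u) [Group EG]
    [TopologicalSpace EG] where
  ι : G →* EG
  isClosedEmbedding_ι : IsClosedEmbedding ι
  contractible : ContractibleSpace EG
  locallyTrivial : IsLocallyTrivial (QuotientGroup.mk : EG → EG ⧸ ι.range) fun e g => e * ι g
  α : H →* MulAut EG
  continuous_α : Continuous fun x : H × EG => α x.1 x.2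
  α_ι : ∀ (h : H) (g : G), α h (ι g) = ι (X.α h g)
  α_t : ∀ (g : G) (e : EG), α (X.t g) e = ι g * e * (ι g)⁻¹

namespace UniversalGroup

variable {H G : Type u} [Group H] [TopologicalSpace H] [IsTopologicalGroup H]
  [Group G] [TopologicalSpace G] [IsTopologicalGroup G] {X : CrossedModule H G}
  {EG : Type u} [Group EG] [TopologicalSpace EG] [IsTopologicalGroup EG]

/-- The group `E(H, G) = EG ⋊ H`. -/
abbrev E (W : UniversalGroup X EG) : Type u := EG ⋊[W.α] H

theorem continuous_left (W : UniversalGroup X EG) : Continuous fun x : W.E => x.left :=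
  continuous_fst.comp
    (continuous_induced_dom (f := fun x : W.E => (x.left, x.right)))

theorem continuous_right (W : UniversalGroup X EG) : Continuous fun x : W.E => x.right :=
  continuous_snd.comp
    (continuous_induced_dom (f := fun x : W.E => (x.left, x.right)))

theorem continuous_mk (W : UniversalGroup X EG) {Y : Type*} [TopologicalSpace Y] {a : Y → EG}
    {b : Y → H} (ha : Continuous a) (hb : Continuous b) :
    Continuous fun y => (⟨a y, b y⟩ : W.E) :=
  continuous_induced_rng.2 (ha.prodMk hb)

instance (W : UniversalGroup X EG) : IsTopologicalGroup W.E where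
  continuous_mul := by
    have h1 := W.continuous_left
    have h2 := W.continuous_right
    exact W.continuous_mk ((h1.comp continuous_fst).mul
      (W.continuous_α.comp ((h2.comp continuous_fst).prodMk (h1.comp continuous_snd))))
      ((h2.comp continuous_fst).mul (h2.comp continuous_snd))
  continuous_inv := by
    have h1 := W.continuous_left
    have h2 := W.continuous_right
    exact W.continuous_mk (W.continuous_α.comp (h2.inv.prodMk h1.inv)) h2.inv

/-- The homomorphism `G → E(H, G)`, `g ↦ (g⁻¹, t(g))`. -/
def j (W : UniversalGroup X EG) : G →* W.E where
  toFun g := ⟨(W.ι g)⁻¹, X.t g⟩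
  map_one' := by ext <;> simp
  map_mul' g k := by
    ext
    · simp only [SemidirectProduct.mul_left, W.α_t, map_mul]
      group
    · simp

theorem continuous_j (W : UniversalGroup X EG) : Continuous W.j :=
  W.continuous_mk W.isClosedEmbedding_ι.continuous.inv X.continuous_t

instance (W : UniversalGroup X EG) : W.j.range.Normal where
  conj_mem := by
    rintro _ ⟨g, rfl⟩ x
    refine ⟨X.α x.right g, ?_⟩
    rw [eq_mul_inv_iff_mul_eq]
    ext
    · change (W.ι (X.α x.right g))⁻¹ * W.α (X.t (X.α x.right g)) x.left
        = x.left * W.α x.right (W.ι g)⁻¹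
      rw [W.α_t, map_inv, W.α_ι]
      group
    · change X.t (X.α x.right g) * x.right = x.right * X.t g
      rw [X.t_α, inv_mul_cancel_right]

/-- The group `B(H, G) = E(H, G) / G`; it is a topological group, and the projection
`E(H, G) → B(H, G)` is a homomorphism. -/
abbrev B (W : UniversalGroup X EG) : Type u := W.E ⧸ W.j.range

/-- The homomorphism `B(H, G) → H / t(G)`, `[e, h] ↦ [h]`. -/
def typeHom (W : UniversalGroup X EG) : W.B →* H ⧸ X.t.range :=
  QuotientGroup.map _ _ SemidirectProduct.rightHom (by
    rintro _ ⟨g, rfl⟩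
    exact ⟨g, rfl⟩)

/-- The bibundle `E(H, G) → B(H, G)`, with right action `(e, h) g = (e, h)(g⁻¹, t(g))` and
structure map `(e, h) ↦ h`. -/
def bibundle (W : UniversalGroup X EG) : Bibundle X W.B where
  Total := W.E
  act x g := x * W.j g
  act_one x := by simp
  act_act x g k := by simp [mul_assoc]
  continuous_act := continuous_fst.mul (W.continuous_j.comp continuous_snd)
  proj := QuotientGroup.mk
  continuous_proj := continuous_quotient_mk'
  proj_act x g := QuotientGroup.mk_mul_of_mem x ⟨g, rfl⟩
  locallyTrivial := by
    refine isLocallyTrivial_of_localData continuous_quotient_mk'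
      (continuous_fst.mul (W.continuous_j.comp continuous_snd))
      (fun x g => QuotientGroup.mk_mul_of_mem x ⟨g, rfl⟩) fun b => ?_
    let q : W.E → EG := fun x => W.α x.right⁻¹ x.left⁻¹
    have cq : Continuous q :=
      W.continuous_α.comp (W.continuous_right.inv.prodMk W.continuous_left.inv)
    have hq : ∀ (x : W.E) (g : G), q (x * W.j g) = q x * W.ι g := by
      intro x g
      change W.α (x.right * X.t g)⁻¹ (x.left * W.α x.right (W.ι g)⁻¹)⁻¹
        = W.α x.right⁻¹ x.left⁻¹ * W.ι g
      have h1 : ∀ y, W.α x.right⁻¹ (W.α x.right y) = y := fun y => by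
        rw [← MulAut.mul_apply, ← map_mul, inv_mul_cancel, map_one, MulAut.one_apply]
      rw [mul_inv_rev (x.right), map_mul, MulAut.mul_apply, mul_inv_rev x.left, map_mul,
        ← map_inv (W.α x.right), inv_inv, h1, ← map_inv X.t, W.α_t, map_inv W.ι]
      group
    let q' : W.B → EG ⧸ W.ι.range := Quotient.lift (fun x => QuotientGroup.mk (q x)) (by
      intro x y hxy
      obtain ⟨g, hg⟩ := QuotientGroup.leftRel_apply.1 hxy
      have : y = x * W.j g := by rw [hg, mul_inv_cancel_left]
      rw [this, hq]
      exact (QuotientGroup.mk_mul_of_mem (s := W.ι.range) (q x) ⟨g, rfl⟩).symm)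
    have cq' : Continuous q' := Continuous.quotient_lift (continuous_quotient_mk'.comp cq) _
    obtain ⟨L⟩ := W.locallyTrivial.localData (q' b)
    have cd : ContinuousOn (fun x : W.E => L.d (q x)) (QuotientGroup.mk ⁻¹' (q' ⁻¹' L.U)) :=
      L.continuousOn_d.comp cq.continuousOn fun x hx => hx
    have hd : ∀ x : W.E, q' x ∈ L.U → ∀ g, L.d (q (x * W.j g)) = L.d (q x) * g := fun x hx g => by
      rw [hq]
      exact L.d_act (q x) hx g
    let S : W.B → W.E := fun c => c.out * W.j (L.d (q c.out))⁻¹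
    have hS : ∀ x : W.E, q' x ∈ L.U → S x = x * W.j (L.d (q x))⁻¹ := by
      intro x hx
      obtain ⟨⟨n, ⟨g, rfl⟩⟩, h⟩ := QuotientGroup.mk_out_eq_mul W.j.range x
      change (Quotient.out (x : W.B)) * W.j (L.d (q (Quotient.out (x : W.B))))⁻¹ = _
      rw [h, hd x hx]
      simp
    have cS : ContinuousOn S (q' ⁻¹' L.U) := by
      have hqm : IsQuotientMap (QuotientGroup.mk : W.E → W.B) := isQuotientMap_quotient_mk'
      rw [hqm.continuousOn_isOpen_iff (L.isOpen.preimage cq')]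
      have : ContinuousOn (fun x : W.E => x * W.j (L.d (q x))⁻¹)
          (QuotientGroup.mk ⁻¹' (q' ⁻¹' L.U)) :=
        continuousOn_id.mul (W.continuous_j.comp_continuousOn cd.inv)
      exact this.congr fun x hx => hS x hx
    refine ⟨{ U := q' ⁻¹' L.U
              isOpen := L.isOpen.preimage cq'
              mem := L.mem
              s := fun v => S v
              d := fun x => L.d (q x)
              continuous_s := cS.comp_continuous continuous_subtype_val fun v => v.2
              proj_s := ?_
              continuousOn_d := cd
              act_d := ?_
              d_act := hd }⟩
    · rintro ⟨c, hc⟩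
      refine (QuotientGroup.mk_mul_of_mem (s := W.j.range) c.out ⟨_, rfl⟩).trans ?_
      exact Quotient.out_eq c
    · intro x hx
      change S x * _ = x
      rw [hS x hx]
      simp
  ψ x := x.right
  continuous_ψ := W.continuous_right
  ψ_act _ _ := rfl

/-- Two maps `f, k : M → B(H, G)` are homotopic over `H / t(G)` if there is a homotopy from `f` to
`k` whose composite with `B(H, G) → H / t(G)` is constant in time. The relation is compatible with
pointwise multiplication. -/
def homotopyCon (W : UniversalGroup X EG) (M : Type u) [TopologicalSpace M] : Con C(M, W.B) where
  r f k := ContinuousMap.HomotopicWith f k fun l => ∀ m, W.typeHom (l m) = W.typeHom (f m)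
  iseqv :=
    { refl := fun f => ContinuousMap.HomotopicWith.refl f fun _ => rfl
      symm := by
        rintro f k ⟨F⟩
        have hk : ∀ m, W.typeHom (k m) = W.typeHom (f m) := fun m => by
          have := F.prop 1 m
          simpa using this
        refine ⟨⟨F.symm.toHomotopy, fun t m => ?_⟩⟩
        rw [hk]
        exact F.symm.prop t m
      trans := by
        rintro f k l ⟨F⟩ ⟨K⟩
        have hk : ∀ m, W.typeHom (k m) = W.typeHom (f m) := fun m => by
          have := F.prop 1 m
          simpa using this
        exact ⟨F.trans ⟨K.toHomotopy, fun t m => (K.prop t m).trans (hk m)⟩⟩ }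
  mul' := by
    rintro f k f' k' ⟨F⟩ ⟨F'⟩
    refine ⟨⟨⟨⟨fun x => F x * F' x, F.continuous.mul F'.continuous⟩, fun m => ?_, fun m => ?_⟩,
      fun t m => ?_⟩⟩
    · change F (0, m) * F' (0, m) = f m * f' m
      simp
    · change F (1, m) * F' (1, m) = k m * k' m
      simp
    · change W.typeHom (F (t, m) * F' (t, m)) = W.typeHom (f m * f' m)
      have h1 : W.typeHom (F (t, m)) = W.typeHom (f m) := F.prop t m
      have h2 : W.typeHom (F' (t, m)) = W.typeHom (f' m) := F'.prop t m
      rw [map_mul, map_mul, h1, h2]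

/-- The group `[M, B(H, G)]_{H / t(G)}` of homotopy classes over `H / t(G)` of continuous maps
`M → B(H, G)`, with the product induced by the pointwise product of maps. -/
abbrev HomotopyClasses (W : UniversalGroup X EG) (M : Type u) [TopologicalSpace M] : Type u :=
  (W.homotopyCon M).Quotient

/-- The homotopy class over `H / t(G)` of a map. -/
def homotopyClass (W : UniversalGroup X EG) {M : Type u} [TopologicalSpace M] (F : C(M, W.B)) :
    W.HomotopyClasses M := (F : (W.homotopyCon M).Quotient)

end UniversalGroup

/-! Since `E(H, G) → B(H, G)` is a homomorphism, multiplying points of `F^* E(H, G)` and `K^* E(H,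
G)` gives a morphism from their tensor product to `(F K)^* E(H, G)`. So `F ↦ [F^* E(H, G)]` is a
homomorphism of groups (`classHom`). The theorem says that it is surjective (`classHom_surjective`)
and that its kernel congruence is homotopy over `H / t(G)` (`homotopyCon_eq_ker`).

Surjectivity: over a paracompact Hausdorff base a principal `G`-bundle `P` has a `G`-equivariant map
`q` to `EG`, assembled from local trivializations by a partition of unity and a contraction of `EG`
(`PrincipalBundle.exists_equivariant`). Together `q` and `ψ` give an equivariant map `P → E(H, G)`
that preserves structure maps; on base spaces it is the required `F`.

Kernel: `F^* E(H, G)` is trivial exactly when it has a global section with structure map `1`, that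
is, when `F` lifts through `EG → B(H, G)`, `e ↦ [e, 1]`. Contracting `EG` turns a lift into a
homotopy from `1` to `F` inside the kernel of `B(H, G) → H / t(G)`. Conversely `EG → B(H, G)` has
local sections near `1` over that kernel (`exists_local_section_ofEG`), by the assumptions on `t`. A
homotopy in the kernel starting at `1` is a product of small increments, each of which lifts, so its
end lifts too (`exists_lift_of_homotopy`). -/

/-! ### Lifting the end of a homotopy through a homomorphism with local sections -/

/-- The increment is `1` at `u = 0`, so compactness of `[0, 1]` gives a step size valid near each
`m`. The valid sizes at a given `m` form an interval, because shrinking a step keeps it valid; a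
partition of unity therefore merges the local choices into a continuous `δ`. -/
theorem exists_step_function {B M : Type*} [Group B] [TopologicalSpace B] [IsTopologicalGroup B]
    [TopologicalSpace M] [T2Space M] [ParacompactSpace M] {V : Set B} (hV : V ∈ 𝓝 1)
    {F : ℝ × M → B} (hF : Continuous F) :
    ∃ δ : C(M, ℝ), ∀ m, 0 < δ m ∧
      ∀ u, 0 ≤ u → u ≤ δ m → ∀ t ∈ Set.Icc (0 : ℝ) 1, F (t + u, m) * (F (t, m))⁻¹ ∈ V := by
  refine exists_continuous_forall_mem_convex_of_local_const
    (t := fun m => {δ : ℝ | 0 < δ ∧ ∀ u, 0 ≤ u → u ≤ δ → ∀ t ∈ Set.Icc (0 : ℝ) 1,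
      F (t + u, m) * (F (t, m))⁻¹ ∈ V}) (fun m => ?_) (fun m => ?_)
  · refine Set.OrdConnected.convex ⟨?_⟩
    rintro a ⟨ha, -⟩ b ⟨-, hb⟩ c ⟨hac, hcb⟩
    exact ⟨ha.trans_le hac, fun u h0 h1 => hb u h0 (h1.trans hcb)⟩
  · have hc : Continuous fun z : (ℝ × M) × ℝ =>
        F (z.2 + z.1.1, z.1.2) * (F (z.2, z.1.2))⁻¹ :=
      (hF.comp (by fun_prop)).mul (hF.comp (by fun_prop)).inv
    have h1 : ∀ᶠ x in 𝓝 ((0 : ℝ), m), ∀ t ∈ Set.Icc (0 : ℝ) 1,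
        F (t + x.1, x.2) * (F (t, x.2))⁻¹ ∈ V := by
      refine isCompact_Icc.eventually_forall_of_forall_eventually fun t _ => ?_
      refine hc.continuousAt.eventually_mem ?_
      simpa using hV
    rw [nhds_prod_eq] at h1
    obtain ⟨p, hp, q, hq, hpq⟩ := Filter.eventually_prod_iff.1 h1
    obtain ⟨ε, hε, hball⟩ := Metric.eventually_nhds_iff.1 hp
    -- Half of `ε`, because `u = δ` is allowed whereas the ball is open.
    refine ⟨ε / 2, hq.mono fun y hy => ⟨half_pos hε, fun u h0 hu t ht => ?_⟩⟩
    refine hpq (hball ?_) hy t ht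
    rw [Real.dist_eq, sub_zero, abs_of_nonneg h0]
    linarith

/-- Let `π : E → B` be a homomorphism with a section `s` over a neighbourhood of `1` in a subgroup
`K`. The end of a homotopy in `K` that starts at the constant map `1` lifts to `E`. -/
theorem exists_lift_of_homotopy {E B M : Type*} [Group E] [TopologicalSpace E]
    [IsTopologicalGroup E] [Group B] [TopologicalSpace B] [IsTopologicalGroup B]
    [TopologicalSpace M] [T2Space M] [ParacompactSpace M] (π : E →* B) (K : Subgroup B)
    {V : Set B} (hV : V ∈ 𝓝 1) {s : B → E} (hs : ContinuousOn s (V ∩ K)) (hs1 : s 1 = 1)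
    (hπ : ∀ b ∈ V ∩ K, π (s b) = b) {F : ℝ × M → B} (hF : Continuous F)
    (hFK : ∀ x, F x ∈ K) (hF0 : ∀ m, F (0, m) = 1) :
    ∃ e : M → E, Continuous e ∧ ∀ m, π (e m) = F (1, m) := by
  obtain ⟨δ, hδ⟩ := exists_step_function hV hF
  -- The subdivision times, depending on `m`: steps of length `δ m` until time `1`, constant from
  -- then on.
  let r : ℕ → M → ℝ := fun n m => min (n * δ m) 1
  have cr : ∀ n, Continuous (r n) := fun n => by fun_prop
  let c : ℕ → M → B := fun n m => F (r (n + 1) m, m) * (F (r n m, m))⁻¹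
  have cc : ∀ n, Continuous (c n) := fun n =>
    (hF.comp ((cr _).prodMk continuous_id)).mul (hF.comp ((cr _).prodMk continuous_id)).inv
  have hc : ∀ n m, c n m ∈ V ∩ K := by
    intro n m
    refine ⟨?_, K.mul_mem (hFK _) (K.inv_mem (hFK _))⟩
    have hd := (hδ m).1
    have hn : (0 : ℝ) ≤ n * δ m := by positivity
    have h1 : ((n + 1 : ℕ) : ℝ) * δ m = n * δ m + δ m := by push_cast; ring
    have h2 : r n m ≤ r (n + 1) m := min_le_min_right _ (by rw [h1]; linarith)
    have h3 : r (n + 1) m ≤ r n m + δ m := by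
      simp only [r, h1]
      rw [min_add]
      exact min_le_min_left _ (by linarith)
    have := (hδ m).2 (r (n + 1) m - r n m) (by linarith) (by linarith) (r n m)
      ⟨le_min hn zero_le_one, min_le_right _ _⟩
    rwa [add_sub_cancel] at this
  -- The product of the lifted increments. Once the time has reached `1` the increments are `1`, and
  -- `s 1 = 1` makes the sequence stationary.
  let e : ℕ → M → E := fun n => Nat.rec (fun _ => 1) (fun n f m => s (c n m) * f m) n
  have e_succ : ∀ n m, e (n + 1) m = s (c n m) * e n m := fun _ _ => rfl
  have ce : ∀ n, Continuous (e n) := by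
    intro n
    induction n with
    | zero => exact continuous_const
    | succ n ih => exact (hs.comp_continuous (cc n) (hc n)).mul ih
  have πe : ∀ n m, π (e n m) = F (r n m, m) := by
    intro n m
    induction n with
    | zero => simp [e, r, hF0]
    | succ n ih => rw [e_succ, map_mul, hπ _ (hc n m), ih, inv_mul_cancel_right]
  have stab : ∀ (m : M) (n n' : ℕ), 1 ≤ n * δ m → n ≤ n' → e n' m = e n m := by
    intro m n n' h1 h
    induction n', h using Nat.le_induction with
    | base => rfl
    | succ k hk ih =>
      have hd := (hδ m).1
      have h2 : (n : ℝ) ≤ k := by exact_mod_cast hk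
      have h3 : 1 ≤ k * δ m := h1.trans (by gcongr)
      have h4 : 1 ≤ ((k + 1 : ℕ) : ℝ) * δ m := h3.trans (by gcongr; simp)
      rw [e_succ, ih]
      simp only [c, r, min_eq_right h3, min_eq_right h4, mul_inv_cancel, hs1, one_mul]
  let N : M → ℕ := fun m => ⌈1 / δ m⌉₊
  have hN : ∀ m, 1 ≤ N m * δ m := fun m => (div_le_iff₀ (hδ m).1).1 (Nat.le_ceil _)
  refine ⟨fun m => e (N m) m, ?_, fun m => ?_⟩
  · rw [continuous_iff_continuousAt]
    intro m₀
    have hd := (hδ m₀).1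
    -- The number of steps `N m` jumps with `m`. Near `m₀` one has `δ m > δ m₀ / 2`, so this single
    -- index is past the stationary point for all nearby `m`.
    refine ((ce ⌈2 / δ m₀⌉₊).continuousAt (x := m₀)).congr ?_
    filter_upwards [δ.continuous.continuousAt.eventually_mem (Ioi_mem_nhds (half_lt_self hd))]
      with m hm
    refine stab m (N m) _ (hN m) (Nat.ceil_le_ceil ?_)
    rw [div_le_div_iff₀ (hδ m).1 hd]
    have : δ m₀ / 2 < δ m := hm
    linarith
  · rw [πe, show r (N m) m = 1 from min_eq_right (hN m)]

/-! ### Equivariant maps from a principal bundle to a contractible group -/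

section Glue

variable {ι E : Type*} [Group E]

/-- The weighted combination, along a list of indices, of elements `y i` with weights `w i`, by means
of a family of maps `k r : E → E`; the first component is the total weight. -/
noncomputable def glue (k : ℝ → E → E) (w : ι → ℝ) (y : ι → E) : List ι → ℝ × E
  | [] => (0, 1)
  | i :: l => ((glue k w y l).1 + w i,
      k ((glue k w y l).1 / ((glue k w y l).1 + w i)) ((glue k w y l).2 * (y i)⁻¹) * y i)

variable {k : ℝ → E → E} {w : ι → ℝ} {y : ι → E}

theorem glue_fst (l : List ι) : (glue k w y l).1 = (l.map w).sum := by
  induction l with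
  | nil => rfl
  | cons i l ih => rw [glue, ih, List.map_cons, List.sum_cons, add_comm]

theorem glue_fst_nonneg (hw : ∀ i, 0 ≤ w i) (l : List ι) : 0 ≤ (glue k w y l).1 := by
  induction l with
  | nil => exact le_rfl
  | cons i l ih => exact add_nonneg ih (hw i)

/-- The ratio of weights is then `1`, where the contraction is the identity. Positivity of the
remaining weight excludes `0 / 0`. -/
theorem glue_cons_of_eq_zero (k1 : ∀ x, k 1 x = x) {i : ι} {l : List ι} (hi : w i = 0)
    (hl : 0 < (glue k w y l).1) : (glue k w y (i :: l)).2 = (glue k w y l).2 := by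
  rw [glue, hi, add_zero, div_self hl.ne', k1, inv_mul_cancel_right]

/-- Each stage has the form `k r (x * y⁻¹) * y`, and `x * y⁻¹` does not change when both factors are
translated by `g` on the right. The initial value `1` is not translated, but it enters only at ratio
`0`, where `k` is constant. This is the source of equivariance. -/
theorem glue_smul {c : E} (k0 : ∀ x, k 0 x = c) (k1 : ∀ x, k 1 x = x) (hw : ∀ i, 0 ≤ w i)
    {y' : ι → E} {g : E} (h : ∀ i, w i ≠ 0 → y' i = y i * g) (l : List ι)
    (hl : 0 < (glue k w y l).1) : (glue k w y' l).2 = (glue k w y l).2 * g := by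
  have hf : ∀ l, (glue k w y' l).1 = (glue k w y l).1 := fun l => by rw [glue_fst, glue_fst]
  induction l with
  | nil => exact absurd hl (lt_irrefl _)
  | cons i l ih =>
    by_cases hi : w i = 0
    · have hl' : 0 < (glue k w y l).1 := by simpa [glue, hi] using hl
      rw [glue_cons_of_eq_zero k1 hi hl', glue_cons_of_eq_zero k1 hi (by rwa [hf]), ih hl']
    · rcases (glue_fst_nonneg (k := k) (y := y) hw l).eq_or_lt with h0 | h0
      · simp only [glue, hf, ← h0, zero_div, k0, h i hi, mul_assoc]
      · simp only [glue, hf, ih h0, h i hi]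
        rw [mul_inv_rev, mul_assoc _ g, mul_inv_cancel_left, mul_assoc]

open Classical in
-- Indices of weight zero can be dropped, so the value depends only on the support of the weights.
-- Hence nearby points, whose supports differ, can be treated with one common finite list.
theorem glue_filter {c : E} (k0 : ∀ x, k 0 x = c) (k1 : ∀ x, k 1 x = x) (hw : ∀ i, 0 ≤ w i)
    (l : List ι) : (glue k w y (l.filter fun i => w i ≠ 0)).1 = (glue k w y l).1 ∧
      (0 < (glue k w y l).1 →
        (glue k w y (l.filter fun i => w i ≠ 0)).2 = (glue k w y l).2) := by
  induction l with
  | nil => exact ⟨rfl, fun _ => rfl⟩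
  | cons i l ih =>
    by_cases hi : w i = 0
    · have : (i :: l).filter (fun i => w i ≠ 0) = l.filter fun i => w i ≠ 0 := by simp [hi]
      rw [this]
      have h1 : (glue k w y (i :: l)).1 = (glue k w y l).1 := by simp [glue, hi]
      refine ⟨ih.1.trans h1.symm, fun h => ?_⟩
      rw [h1] at h
      rw [ih.2 h, glue_cons_of_eq_zero k1 hi h]
    · have : (i :: l).filter (fun i => w i ≠ 0) = i :: l.filter fun i => w i ≠ 0 := by simp [hi]
      rw [this]
      refine ⟨by rw [glue, glue, ih.1], fun _ => ?_⟩
      rcases (glue_fst_nonneg (k := k) (y := y) hw l).eq_or_lt with h0 | h0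
      · simp only [glue, ih.1, ← h0, zero_div, k0]
      · simp only [glue, ih.1, ih.2 h0]

/-- Two discontinuities have to be harmless. A `y i` may jump where its weight vanishes locally, but
there the index has no effect. The value of the tail may jump where the tail weight tends to `0`,
but there the ratio is below `a` and `k` ignores its argument; this is why `k` must be constant near
`0` and not only at `0`. -/
theorem continuousAt_glue [TopologicalSpace E] [IsTopologicalGroup E] {Z : Type*}
    [TopologicalSpace Z] {c : E} {a : ℝ} (ha : 0 < a) (ka : ∀ r x, r < a → k r x = c)
    (k1 : ∀ x, k 1 x = x) (hk : Continuous fun x : ℝ × E => k x.1 x.2)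
    {w : Z → ι → ℝ} {y : Z → ι → E} (hw : ∀ z i, 0 ≤ w z i) (cw : ∀ i, Continuous fun z => w z i)
    (cy : ∀ i z, (¬ ∀ᶠ z' in 𝓝 z, w z' i = 0) → ContinuousAt (fun z => y z i) z)
    (l : List ι) (z₀ : Z) (h : 0 < (glue k (w z₀) (y z₀) l).1) :
    ContinuousAt (fun z => (glue k (w z) (y z) l).2) z₀ := by
  have cf : ∀ l, Continuous fun z => (glue k (w z) (y z) l).1 := by
    intro l
    induction l with
    | nil => exact continuous_const
    | cons i l ih => exact ih.add (cw i)
  induction l with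
  | nil => exact absurd h (lt_irrefl _)
  | cons i l ih =>
    by_cases h0 : ∀ᶠ z in 𝓝 z₀, w z i = 0
    · have h1 : 0 < (glue k (w z₀) (y z₀) l).1 := by simpa [glue, h0.self_of_nhds] using h
      refine (ih h1).congr ?_
      filter_upwards [h0, (cf l).continuousAt.eventually_mem (Ioi_mem_nhds h1)] with z hz hz'
      exact (glue_cons_of_eq_zero k1 hz hz').symm
    · have cyi := cy i z₀ h0
      have cd : ContinuousAt (fun z => (glue k (w z) (y z) l).1
          / ((glue k (w z) (y z) l).1 + w z i)) z₀ :=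
        (cf l).continuousAt.div ((cf l).add (cw i)).continuousAt h.ne'
      rcases (glue_fst_nonneg (k := k) (y := y z₀) (hw z₀) l).eq_or_lt with h1 | h1
      · refine (continuousAt_const.mul cyi : ContinuousAt (fun z => c * y z i) z₀).congr ?_
        have h2 := cd.eventually_mem (Iio_mem_nhds (by simpa only [← h1, zero_div] using ha))
        filter_upwards [h2] with z hz
        rw [glue, ka _ _ hz]
        rfl
      · exact (hk.continuousAt.comp (cd.prodMk ((ih h1).mul cyi.inv))).mul cyi

end Glue

/-- The contraction of a contractible space, parametrized by `ℝ` and constant near `0`. -/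
theorem exists_contraction (E : Type*) [TopologicalSpace E] [ContractibleSpace E] :
    ∃ (k : ℝ → E → E) (c : E), Continuous (fun x : ℝ × E => k x.1 x.2) ∧
      (∀ r x, r < 1 / 2 → k r x = c) ∧ ∀ x, k 1 x = x := by
  obtain ⟨c, ⟨h⟩⟩ := id_nullhomotopic E
  -- The homotopy runs from the identity to the constant `c`. The clamped time `2 - 2 r` reverses
  -- it: `r = 1` gives the identity, and every `r ≤ 1 / 2` gives `c`.
  refine ⟨fun r x => h (Set.projIcc 0 1 zero_le_one (2 - 2 * r), x), c, ?_, fun r x hr => ?_,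
    fun x => ?_⟩
  · exact h.continuous.comp ((continuous_projIcc.comp (by fun_prop)).prodMk continuous_snd)
  · dsimp only
    rw [Set.projIcc_of_right_le zero_le_one (by linarith : (1 : ℝ) ≤ 2 - 2 * r)]
    exact h.apply_one x
  · dsimp only
    rw [Set.projIcc_of_le_left zero_le_one (by norm_num)]
    exact h.apply_zero x

/-- A principal `G`-bundle on a paracompact Hausdorff space has an equivariant map to every
contractible topological group that `G` maps to. -/
theorem PrincipalBundle.exists_equivariant {G M : Type u} {E : Type*} [Group G]
    [TopologicalSpace G] [TopologicalSpace M] [T2Space M] [ParacompactSpace M] [Group E]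
    [TopologicalSpace E] [IsTopologicalGroup E] [ContractibleSpace E] (P : PrincipalBundle G M)
    (ι : G →* E) (hι : Continuous ι) :
    ∃ q : P.Total → E, Continuous q ∧ ∀ p g, q (P.act p g) = q p * ι g := by
  classical
  obtain ⟨k, c, ck, k0, k1⟩ := exists_contraction E
  let L : ∀ m, LocalData P.proj P.act m := fun m => (P.locallyTrivial.localData m).some
  obtain ⟨ρ, hρ⟩ := PartitionOfUnity.exists_isSubordinate (s := (Set.univ : Set M)) isClosed_univ
    (fun m => (L m).U) (fun m => (L m).isOpen) fun m _ => Set.mem_iUnion.2 ⟨m, (L m).mem⟩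
  -- The gluing depends on the order of the indices, so a well-ordering of the index set fixes one
  -- order for all finite subsets.
  let _ : LinearOrder M := linearOrderOfSTO WellOrderingRel
  let w : P.Total → M → ℝ := fun p i => ρ i (P.proj p)
  let y : P.Total → M → E := fun p i => ι ((L i).d p)
  have hw : ∀ p i, 0 ≤ w p i := fun p i => ρ.nonneg i _
  have k0' : ∀ x, k 0 x = c := fun x => k0 0 x (by norm_num)
  let Q : Finset M → P.Total → ℝ × E := fun S p => glue k (w p) (y p) (S.sort (· ≤ ·))
  -- Any finite set containing the support at `p` gives the same value. The value is defined with
  -- the support itself, and continuity is checked with a set `S` that works on a neighbourhood.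
  have hQ : ∀ (S : Finset M) (p : P.Total), ρ.finsupport (P.proj p) ⊆ S →
      0 < (Q S p).1 ∧ (Q (ρ.finsupport (P.proj p)) p).2 = (Q S p).2 := by
    intro S p hS
    have hmem : ∀ i, i ∈ ρ.finsupport (P.proj p) ↔ w p i ≠ 0 := fun i => by
      rw [ρ.mem_finsupport]; rfl
    have h1 : (S.sort (· ≤ ·)).filter (fun i => w p i ≠ 0)
        = (ρ.finsupport (P.proj p)).sort (· ≤ ·) := by
      refine List.Perm.eq_of_pairwise' ((S.pairwise_sort _).filter _) (Finset.pairwise_sort _ _) ?_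
      rw [List.perm_ext_iff_of_nodup ((S.sort_nodup _).filter _) (Finset.sort_nodup _ _)]
      intro i
      simp only [List.mem_filter, Finset.mem_sort, decide_eq_true_eq, hmem]
      exact ⟨fun h => h.2, fun h => ⟨hS ((hmem i).2 h), h⟩⟩
    have h2 : 0 < (Q S p).1 := by
      have h3 : (Q S p).1 = ∑ i ∈ S, w p i := by
        rw [glue_fst, ← List.sum_toFinset _ (S.sort_nodup _), Finset.sort_toFinset]
      rw [h3]
      obtain ⟨i, hi⟩ := ρ.exists_pos (Set.mem_univ (P.proj p))
      exact Finset.sum_pos' (fun i _ => hw p i) ⟨i, hS ((hmem i).2 hi.ne'), hi⟩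
    refine ⟨h2, ?_⟩
    have := (glue_filter (y := y p) k0' k1 (hw p) (S.sort (· ≤ ·))).2 h2
    rwa [h1] at this
  refine ⟨fun p => (Q (ρ.finsupport (P.proj p)) p).2, ?_, fun p g => ?_⟩
  · rw [continuous_iff_continuousAt]
    intro p
    obtain ⟨S, hS⟩ := ρ.exists_finset_nhds (P.proj p)
    have hS' : ∀ᶠ p' in 𝓝 p, ρ.finsupport (P.proj p') ⊆ S := by
      filter_upwards [P.continuous_proj.continuousAt.eventually hS] with p' hp' i hi
      exact hp'.2 (by rwa [ρ.mem_finsupport] at hi)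
    refine ContinuousAt.congr (f := fun p => (Q S p).2) ?_
      (hS'.mono fun p' hp' => (hQ S p' hp').2.symm)
    refine continuousAt_glue one_half_pos k0 k1 ck hw
      (fun i => (ρ i).continuous.comp P.continuous_proj) (fun i p hp => ?_) _ p
      (hQ S p hS'.self_of_nhds).1
    -- If the weight does not vanish near `p`, the base point lies in the closed support of `ρ i`,
    -- hence in the domain where the fibre coordinate is continuous.
    have hi : P.proj p ∈ (L i).U := by
      refine hρ i ?_
      by_contra hn
      exact hp (P.continuous_proj.continuousAt.eventually (notMem_tsupport_iff_eventuallyEq.1 hn))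
    exact hι.continuousAt.comp ((L i).continuousOn_d.continuousAt
      (((L i).isOpen.preimage P.continuous_proj).mem_nhds hi))
  · dsimp only
    rw [P.proj_act]
    have hw' : w (P.act p g) = w p := by funext i; simp only [w, P.proj_act]
    simp only [Q, hw']
    refine glue_smul k0' k1 (hw p) (fun i hi => ?_) _ (hQ _ p subset_rfl).1
    have hm : P.proj p ∈ (L i).U := hρ i (subset_tsupport _ hi)
    simp only [y, (L i).d_act p hm, map_mul]

/-! ### Local sections of `t` and of `EG → B(H, G)` -/

/-- A local section of `G → G / ker t` is transported along the homeomorphism of `G / ker t` with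
`t(G)`. An open set of `t(G)` is the trace of an open `N ⊆ H` because `t(G)` has the subspace
topology. -/
theorem CrossedModule.IsAdmissible.exists_local_section_t {H G : Type u} [Group H]
    [TopologicalSpace H] [Group G] [TopologicalSpace G] {X : CrossedModule H G}
    (hX : X.IsAdmissible) :
    ∃ N ∈ 𝓝 (1 : H), ∃ τ : H → G, ContinuousOn τ (N ∩ X.t.range) ∧
      ∀ n ∈ N ∩ X.t.range, X.t (τ n) = n := by
  classical
  obtain ⟨U, hU, h1, σ, cσ, hσ⟩ := hX.localSections_ker 1
  let φ := QuotientGroup.quotientKerEquivRange X.t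
  have cφ : Continuous φ.symm :=
    (hX.isHomeomorph_range.homeomorph _).continuous_symm
  obtain ⟨N, hN, hNU⟩ := isOpen_induced_iff.1 (hU.preimage cφ)
  have hmem : ∀ n : X.t.range, (n : H) ∈ N → φ.symm n ∈ U := fun n hn => by
    change n ∈ φ.symm ⁻¹' U
    rw [← hNU]
    exact hn
  let τ : H → G := fun n => if h : ∃ hn : n ∈ X.t.range, n ∈ N then
    σ ⟨φ.symm ⟨n, h.1⟩, hmem _ h.2⟩ else 1
  have hτ : ∀ n : (N ∩ X.t.range : Set H), τ n = σ ⟨φ.symm ⟨n, n.2.2⟩, hmem ⟨n, n.2.2⟩ n.2.1⟩ :=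
    fun n => dif_pos (⟨n.2.2, n.2.1⟩ : ∃ hn : (n : H) ∈ X.t.range, (n : H) ∈ N)
  refine ⟨N, hN.mem_nhds ?_, τ, ?_, fun n hn => ?_⟩
  · have : (1 : X.t.range) ∈ Subtype.val ⁻¹' N := by
      rw [hNU]
      change φ.symm 1 ∈ U
      rwa [map_one]
    exact this
  · rw [continuousOn_iff_continuous_domRestrict]
    refine Continuous.congr (f := fun n : (N ∩ X.t.range : Set H) =>
      σ ⟨φ.symm ⟨n, n.2.2⟩, hmem ⟨n, n.2.2⟩ n.2.1⟩) ?_ fun n => (hτ n).symm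
    exact cσ.comp ((cφ.comp (continuous_subtype_val.subtype_mk _)).subtype_mk _)
  · rw [hτ ⟨n, hn⟩]
    have h2 := congrArg φ (hσ ⟨φ.symm ⟨n, hn.2⟩, hmem ⟨n, hn.2⟩ hn.1⟩)
    rw [φ.apply_symm_apply] at h2
    exact congrArg Subtype.val h2

theorem LocalData.exists_continuousOn_section {P M G : Type*} [TopologicalSpace P]
    [TopologicalSpace M] [TopologicalSpace G] [Group G] {proj : P → M} {act : P → G → P} {m : M}
    (L : LocalData proj act m) :
    ∃ s : M → P, ContinuousOn s L.U ∧ ∀ x ∈ L.U, proj (s x) = x := by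
  classical
  let s : M → P := fun x => if hx : x ∈ L.U then L.s ⟨x, hx⟩ else L.s ⟨m, L.mem⟩
  have hs : ∀ v : L.U, s v = L.s v := fun v => dif_pos v.2
  refine ⟨s, ?_, fun x hx => ?_⟩
  · rw [continuousOn_iff_continuous_domRestrict]
    exact L.continuous_s.congr fun v => (hs v).symm
  · rw [hs ⟨x, hx⟩, L.proj_s]

namespace UniversalGroup

variable {H G : Type u} [Group H] [TopologicalSpace H] [IsTopologicalGroup H]
  [Group G] [TopologicalSpace G] [IsTopologicalGroup G] {X : CrossedModule H G}
  {EG : Type u} [Group EG] [TopologicalSpace EG] [IsTopologicalGroup EG]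

/-- The homomorphism `EG → B(H, G)`, `e ↦ [e, 1]`. -/
def ofEG (W : UniversalGroup X EG) : EG →* W.B :=
  (QuotientGroup.mk' W.j.range).comp SemidirectProduct.inl

theorem continuous_ofEG (W : UniversalGroup X EG) : Continuous W.ofEG :=
  continuous_quotient_mk'.comp (W.continuous_mk continuous_id continuous_const)

theorem mk_mul_j (W : UniversalGroup X EG) (x : W.E) (g : G) :
    ((x * W.j g : W.E) : W.B) = x :=
  QuotientGroup.mk_mul_of_mem x ⟨g, rfl⟩

theorem typeHom_ofEG (W : UniversalGroup X EG) (e : EG) : W.typeHom (W.ofEG e) = 1 := rfl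

/-- The homomorphism `EG → B(H, G)` has local sections over the kernel of `B(H, G) → H / t(G)`. -/
theorem exists_local_section_ofEG (W : UniversalGroup X EG) (hX : X.IsAdmissible) :
    ∃ V ∈ 𝓝 (1 : W.B), ∃ s : W.B → EG, ContinuousOn s (V ∩ W.typeHom.ker) ∧ s 1 = 1 ∧
      ∀ b ∈ V ∩ W.typeHom.ker, W.ofEG (s b) = b := by
  obtain ⟨N, hN, τ, cτ, hτ⟩ := hX.exists_local_section_t
  obtain ⟨L⟩ := W.bibundle.locallyTrivial.localData (1 : W.B)
  obtain ⟨S, cS, hS⟩ := L.exists_continuousOn_section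
  let S : W.B → W.E := S
  have cS : ContinuousOn S L.U := cS
  have hS : ∀ b ∈ L.U, (S b : W.B) = b := hS
  -- Normalized so that `T 1 = 1`; then `(T b).right` is near `1` for `b` near `1`, where the
  -- section `τ` of `t` is available.
  let T : W.B → W.E := fun b => S b * (S 1)⁻¹
  have cT : ContinuousOn T L.U := cS.mul continuousOn_const
  have hT : ∀ b ∈ L.U, (T b : W.B) = b := fun b hb => by
    rw [QuotientGroup.mk_mul, QuotientGroup.mk_inv, hS b hb, hS 1 L.mem, inv_one, mul_one]
  have cr : ContinuousOn (fun b => (T b).right) L.U := W.continuous_right.comp_continuousOn cT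
  have hU : L.U ∈ 𝓝 (1 : W.B) := L.isOpen.mem_nhds L.mem
  let V : Set W.B := L.U ∩ (fun b => (T b).right) ⁻¹' N
  have hV : V ∈ 𝓝 (1 : W.B) := by
    refine Filter.inter_mem hU ((cr.continuousAt hU).preimage_mem_nhds ?_)
    simpa [T] using hN
  have hr : ∀ b ∈ V ∩ W.typeHom.ker, (T b).right ∈ N ∩ X.t.range := by
    rintro b ⟨⟨hb, hbN⟩, hk⟩
    refine ⟨hbN, ?_⟩
    have h1 : W.typeHom (T b : W.B) = 1 := by rw [hT b hb]; exact hk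
    exact (QuotientGroup.eq_one_iff _).1 h1
  -- Over the kernel `(T b).right` lies in `t(G)`. Moving `T b` within its fibre by `τ` makes the
  -- `H`-component `1`, so the result comes from `EG`.
  let u : W.B → W.E := fun b => T b * W.j (τ (T b).right)⁻¹
  have cu : ContinuousOn u (V ∩ W.typeHom.ker) := by
    refine (cT.mono fun b hb => hb.1.1).mul (W.continuous_j.comp_continuousOn ?_)
    exact (cτ.comp (cr.mono fun b hb => hb.1.1) hr).inv
  have hu : ∀ b ∈ V ∩ W.typeHom.ker, W.ofEG (u b).left = b := by
    intro b hb
    have h1 : (SemidirectProduct.inl (u b).left : W.E) = u b := by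
      refine SemidirectProduct.ext rfl ?_
      change 1 = (T b).right * X.t (τ (T b).right)⁻¹
      rw [map_inv, hτ _ (hr b hb), mul_inv_cancel]
    change ((SemidirectProduct.inl (u b).left : W.E) : W.B) = b
    rw [h1, W.mk_mul_j, hT b hb.1.1]
  refine ⟨V, hV, fun b => (u b).left * (u 1).left⁻¹,
    (W.continuous_left.comp_continuousOn cu).mul continuousOn_const, mul_inv_cancel _,
    fun b hb => ?_⟩
  rw [map_mul, map_inv, hu b hb, hu 1 ⟨mem_of_mem_nhds hV, one_mem _⟩, inv_one, mul_one]

/-- On `E(H, G)` the left action `g p = p α(ψ(p))⁻¹(g)` is thus left multiplication by `j g`. This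
makes the product `x y` well defined on the tensor product. -/
theorem j_mul (W : UniversalGroup X EG) (x : W.E) (g : G) :
    x * W.j (X.α x.right⁻¹ g) = W.j g * x := by
  refine SemidirectProduct.ext ?_ ?_
  · change x.left * W.α x.right (W.ι (X.α x.right⁻¹ g))⁻¹
      = (W.ι g)⁻¹ * W.α (X.t g) x.left
    rw [map_inv, W.α_ι, X.α_α_inv, W.α_t]
    group
  · change x.right * X.t (X.α x.right⁻¹ g) = X.t g * x.right
    rw [X.t_α]
    group

/-! ### Pullbacks of the universal bibundle and their products -/

variable {M : Type u} [TopologicalSpace M]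

/-- The point `(m, x)` of `F^* E(H, G)`. -/
def point (W : UniversalGroup X EG) {F : C(M, W.B)} (m : M) (x : W.E) (h : F m = (x : W.B)) :
    (Bibundle.pullback F W.bibundle).Total :=
  ⟨(m, x), h⟩

/-- The component in `E(H, G)` of a point of `F^* E(H, G)`. -/
def toE (W : UniversalGroup X EG) {F : C(M, W.B)} (p : (Bibundle.pullback F W.bibundle).Total) :
    W.E :=
  p.1.2

theorem mk_toE (W : UniversalGroup X EG) {F : C(M, W.B)}
    (p : (Bibundle.pullback F W.bibundle).Total) :
    F ((Bibundle.pullback F W.bibundle).proj p) = (W.toE p : W.B) :=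
  p.2

theorem continuous_point (W : UniversalGroup X EG) {F : C(M, W.B)} {Y : Type*}
    [TopologicalSpace Y] {a : Y → M} {b : Y → W.E} (ha : Continuous a) (hb : Continuous b)
    (h : ∀ y, F (a y) = (b y : W.B)) : Continuous fun y => W.point (a y) (b y) (h y) :=
  (ha.prodMk hb).subtype_mk _

theorem continuous_toE (W : UniversalGroup X EG) {F : C(M, W.B)} :
    Continuous fun p : (Bibundle.pullback F W.bibundle).Total => W.toE p :=
  continuous_snd.comp continuous_subtype_val

theorem point_congr (W : UniversalGroup X EG) {F : C(M, W.B)} {m n : M} {x y : W.E}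
    (hx : F m = (x : W.B)) (hy : F n = (y : W.B)) (hmn : m = n) (hxy : x = y) :
    W.point m x hx = W.point n y hy := by
  subst hmn hxy
  rfl

/-- The morphism `(m, x) ⊗ (m, y) ↦ (m, x y)`. -/
def pullbackTensorHom (W : UniversalGroup X EG) (F K : C(M, W.B)) :
    Bibundle.Hom ((Bibundle.pullback F W.bibundle).tensor (Bibundle.pullback K W.bibundle))
      (Bibundle.pullback (F * K) W.bibundle) where
  toFun := Bibundle.tensorLift
    (fun p q h => W.point ((Bibundle.pullback F W.bibundle).proj p) (W.toE p * W.toE q) (by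
      rw [QuotientGroup.mk_mul, ← W.mk_toE, ← W.mk_toE, ← h, ContinuousMap.mul_apply]))
    (fun p q g _ _ => W.point_congr _ _ rfl (by
      change W.toE p * W.toE q
        = W.toE p * W.j g * (W.toE q * W.j (X.α (W.toE q).right⁻¹ g⁻¹))
      rw [W.j_mul, map_inv, mul_assoc, mul_inv_cancel_left]))
  continuous_toFun := Bibundle.continuous_tensorLift _
    (W.continuous_point
      ((Bibundle.pullback F W.bibundle).continuous_proj.comp
        (continuous_fst.comp continuous_subtype_val))
      ((W.continuous_toE.comp (continuous_fst.comp continuous_subtype_val)).mul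
        (W.continuous_toE.comp (continuous_snd.comp continuous_subtype_val))) _)
  map_act z g := by
    induction z using Bibundle.tensor_ind with
    | h p q h => exact W.point_congr _ _ rfl (mul_assoc (W.toE p) (W.toE q) (W.j g)).symm
  proj_toFun z := by
    induction z using Bibundle.tensor_ind with
    | h p q h => rfl
  ψ_toFun z := by
    induction z using Bibundle.tensor_ind with
    | h p q h => rfl

/-- The homomorphism sending a map `F` to the isomorphism class of `F^* E(H, G)`. -/
def classHom (W : UniversalGroup X EG) (M : Type u) [TopologicalSpace M] :
    C(M, W.B) →* Bibundle.Pi0 X M :=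
  MonoidHom.mk' (fun F => (Bibundle.pullback F W.bibundle).isoClass) fun F K =>
    (Bibundle.isoClass_eq_of_hom (W.pullbackTensorHom F K)).symm

/-! ### The kernel: trivial pullbacks and homotopies to `1` -/

/-- The trivialization of `F^* E(H, G)` given by a lift of `F` to `EG`. -/
def trivialHom (W : UniversalGroup X EG) (F : C(M, W.B)) (e : C(M, EG))
    (he : ∀ m, W.ofEG (e m) = F m) :
    Bibundle.Hom (Bibundle.trivial X M) (Bibundle.pullback F W.bibundle) where
  toFun x := W.point x.1 (SemidirectProduct.inl (e x.1) * W.j x.2)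
    ((he x.1).symm.trans (W.mk_mul_j _ _).symm)
  continuous_toFun := W.continuous_point continuous_fst
    ((W.continuous_mk (e.continuous.comp continuous_fst) continuous_const).mul
      (W.continuous_j.comp continuous_snd)) _
  map_act x g := W.point_congr _ _ rfl (by
    change (SemidirectProduct.inl (e x.1) * W.j (x.2 * g) : W.E)
      = SemidirectProduct.inl (e x.1) * W.j x.2 * W.j g
    rw [map_mul, mul_assoc])
  proj_toFun _ := rfl
  ψ_toFun x := by
    change (1 : H) * X.t x.2 = X.t x.2
    exact one_mul _

/-- The homotopy starts at `1` and is constant over `H / t(G)`, so it stays in the kernel of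
`typeHom`. Its end therefore lifts to `EG`, and a lift trivializes the pullback. -/
theorem classHom_eq_one_of_homotopic (W : UniversalGroup X EG) (hX : X.IsAdmissible)
    [T2Space M] [ParacompactSpace M] {F : C(M, W.B)} (h : W.homotopyCon M 1 F) :
    W.classHom M F = 1 := by
  obtain ⟨Γ⟩ : ContinuousMap.HomotopicWith 1 F fun l : C(M, W.B) =>
    ∀ m, W.typeHom (l m) = W.typeHom ((1 : C(M, W.B)) m) := h
  obtain ⟨V, hV, s, cs, s1, hs⟩ := W.exists_local_section_ofEG hX
  obtain ⟨e, ce, he⟩ := exists_lift_of_homotopy W.ofEG W.typeHom.ker hV cs s1 hs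
    (F := fun x : ℝ × M => Γ (Set.projIcc 0 1 zero_le_one x.1, x.2))
    (Γ.continuous.comp ((continuous_projIcc.comp continuous_fst).prodMk continuous_snd))
    (fun x => (Γ.prop _ x.2).trans (map_one W.typeHom)) (fun m => by simpa using Γ.apply_zero m)
  exact (Bibundle.isoClass_eq_of_hom (W.trivialHom F ⟨e, ce⟩ fun m => by
    simpa using (he m).trans (by simpa using Γ.apply_one m))).symm

/-- The unit section `m ↦ (m, 1)` of the trivial bibundle has structure map `1`. Its image in `E(H,
G)` therefore lies in `EG` and lifts `F`; contracting `EG` deforms this lift. -/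
theorem homotopic_of_classHom_eq_one (W : UniversalGroup X EG) {F : C(M, W.B)}
    (h : W.classHom M F = 1) : W.homotopyCon M 1 F := by
  obtain ⟨f⟩ : Nonempty (Bibundle.Iso (Bibundle.pullback F W.bibundle) (Bibundle.trivial X M)) :=
    Quotient.exact h
  let σ : M → (Bibundle.pullback F W.bibundle).Total := fun m => f.inv.toFun (m, 1)
  have cσ : Continuous σ := f.inv.continuous_toFun.comp (continuous_id.prodMk continuous_const)
  let x : M → W.E := fun m => W.toE (σ m)
  have cx : Continuous x := W.continuous_toE.comp cσ
  have hr : ∀ m, (x m).right = 1 := fun m => (f.inv.ψ_toFun (m, 1)).trans (map_one X.t)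
  have hx : ∀ m, W.ofEG (x m).left = F m := by
    intro m
    have h1 : (Bibundle.pullback F W.bibundle).proj (σ m) = m := f.inv.proj_toFun (m, 1)
    have h2 : F m = (x m : W.B) := by
      rw [← W.mk_toE, h1]
    have h3 : (SemidirectProduct.inl (x m).left : W.E) = x m :=
      SemidirectProduct.ext rfl (hr m).symm
    rw [h2]
    exact congrArg _ h3
  have := W.contractible
  obtain ⟨k, c, ck, k0, k1⟩ := exists_contraction EG
  have ck' : ∀ {Y : Type u} [TopologicalSpace Y] {a : Y → ℝ} {b : Y → EG}, Continuous a →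
      Continuous b → Continuous fun y => k (a y) (b y) := fun ha hb => ck.comp (ha.prodMk hb)
  -- At time `0` both factors come from `c` and cancel; at time `1` the left factor is `1` and the
  -- right one is the lift. The division makes the homotopy start exactly at `1`, whatever `c` is.
  have hc : Continuous fun z : unitInterval × M =>
      W.ofEG ((k z.1 1)⁻¹ * k z.1 (x z.2).left) :=
    W.continuous_ofEG.comp ((ck' (by fun_prop) continuous_const).inv.mul
      (ck' (by fun_prop) (W.continuous_left.comp (cx.comp continuous_snd))))
  refine ⟨⟨⟨⟨_, hc⟩, fun m => ?_, fun m => ?_⟩, fun t m => ?_⟩⟩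
  · simp [k0 0 _ (by norm_num : (0 : ℝ) < 1 / 2)]
  · simp [k1, hx]
  · exact (W.typeHom_ofEG _).trans (map_one W.typeHom).symm

/-- A congruence on a group is determined by the class of `1`, so it suffices to compare maps with
the constant map `1`. -/
theorem homotopyCon_eq_ker (W : UniversalGroup X EG) (hX : X.IsAdmissible)
    (M : Type u) [TopologicalSpace M] [T2Space M] [ParacompactSpace M] :
    W.homotopyCon M = Con.ker (W.classHom M) := by
  ext F K
  have h1 : W.homotopyCon M F K ↔ W.homotopyCon M 1 (F⁻¹ * K) := by
    constructor
    · intro h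
      simpa using (W.homotopyCon M).mul ((W.homotopyCon M).refl F⁻¹) h
    · intro h
      simpa using (W.homotopyCon M).mul ((W.homotopyCon M).refl F) h
  rw [h1, Con.ker_rel]
  have h2 : W.classHom M F = W.classHom M K ↔ W.classHom M (F⁻¹ * K) = 1 := by
    rw [map_mul, map_inv, inv_mul_eq_one]
  rw [h2]
  exact ⟨W.classHom_eq_one_of_homotopic hX, W.homotopic_of_classHom_eq_one⟩

/-! ### Surjectivity: classifying maps -/

theorem classHom_surjective (W : UniversalGroup X EG) (M : Type u) [TopologicalSpace M]
    [T2Space M] [ParacompactSpace M] : Function.Surjective (W.classHom M) := by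
  rintro ⟨P⟩
  have := W.contractible
  obtain ⟨q, cq, hq⟩ := P.exists_equivariant W.ι W.isClosedEmbedding_ι.continuous
  -- The map `(e, h) ↦ α(h)⁻¹(e⁻¹)` from `E(H, G)` to `EG` is `G`-equivariant. Requiring that it
  -- take the value `q p` at a point with `h = ψ p` forces this formula.
  let φ : P.Total → W.E := fun p => ⟨W.α (P.ψ p) (q p)⁻¹, P.ψ p⟩
  have cφ : Continuous φ :=
    W.continuous_mk (W.continuous_α.comp (P.continuous_ψ.prodMk cq.inv)) P.continuous_ψ
  have hφ : ∀ p g, φ (P.act p g) = φ p * W.j g := by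
    intro p g
    refine SemidirectProduct.ext ?_ (P.ψ_act p g)
    change W.α (P.ψ (P.act p g)) (q (P.act p g))⁻¹ = W.α (P.ψ p) (q p)⁻¹ * W.α (P.ψ p) (W.ι g)⁻¹
    rw [P.ψ_act, hq, ← map_mul, map_mul W.α, MulAut.mul_apply, W.α_t]
    congr 1
    group
  have hφ' : ∀ p p', P.proj p = P.proj p' → (φ p : W.B) = φ p' := by
    intro p p' h
    obtain ⟨g, rfl⟩ := P.exists_act_eq h
    rw [hφ, W.mk_mul_j]
  -- A possibly discontinuous choice of a point in each fibre. The class of `φ` is constant on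
  -- fibres, so continuity of `F` can be checked with local sections.
  let s : M → P.Total := fun m =>
    (P.locallyTrivial.localData m).some.s ⟨m, (P.locallyTrivial.localData m).some.mem⟩
  have hs : ∀ m, P.proj (s m) = m := fun m => LocalData.proj_s _ _
  let F : M → W.B := fun m => φ (s m)
  have hF : ∀ p, F (P.proj p) = φ p := fun p => hφ' _ _ (hs _)
  have cF : Continuous F := by
    rw [continuous_iff_continuousAt]
    intro m
    obtain ⟨L⟩ := P.locallyTrivial.localData m
    obtain ⟨r, cr, hr⟩ := L.exists_continuousOn_section
    have hU := L.isOpen.mem_nhds L.mem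
    refine ((continuous_quotient_mk'.comp cφ).continuousAt.comp (cr.continuousAt hU)).congr ?_
    filter_upwards [hU] with n hn
    exact hφ' _ _ ((hr n hn).trans (hs n).symm)
  refine ⟨⟨F, cF⟩, (Bibundle.isoClass_eq_of_hom (P := P)
    { toFun := fun p => W.point (P.proj p) (φ p) (hF p)
      continuous_toFun := W.continuous_point P.continuous_proj cφ hF
      map_act := fun p g => W.point_congr _ _ (P.proj_act p g) (hφ p g)
      proj_toFun := fun _ => rfl
      ψ_toFun := fun _ => rfl }).symm⟩

end UniversalGroup

/-! ### The isomorphism -/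

theorem mainTheorem3 {H G EG M : Type u}
    [Group H] [TopologicalSpace H] [IsTopologicalGroup H]
    [Group G] [TopologicalSpace G] [IsTopologicalGroup G]
    [Group EG] [TopologicalSpace EG] [IsTopologicalGroup EG]
    [TopologicalSpace M] [T2Space M] [ParacompactSpace M]
    (X : CrossedModule H G) (hX : X.IsAdmissible) (W : UniversalGroup X EG) :
    ∃ e : Bibundle.Pi0 X M ≃* W.HomotopyClasses M,
      ∀ F : C(M, W.B), e.symm (W.homotopyClass F) = (Bibundle.pullback F W.bibundle).isoClass := by
  have hker := W.homotopyCon_eq_ker hX M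
  let Φ : W.HomotopyClasses M →* Bibundle.Pi0 X M :=
    (W.homotopyCon M).lift (W.classHom M) hker.le
  have hΦ : Function.Bijective Φ := by
    refine ⟨?_, Con.lift_surjective_of_surjective _ (W.classHom_surjective M)⟩
    rintro ⟨F⟩ ⟨K⟩ h
    refine (Con.eq _).2 ?_
    rw [hker]
    exact h
  exact ⟨(MulEquiv.ofBijective Φ hΦ).symm, fun F => rfl⟩
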